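/- All matroids are finite. A matroid is connected if every two distinct elements lie in a common circuit; a component of a matroid is an inclusion-wise maximal connected restriction. The contraction-depth $\mathrm{cd}(M)$ is defined recursively: $\mathrm{cd}(M)=0$ if $M$ is empty; $\mathrm{cd}(M)=1$ if $M$ has exactly one element; if $M$ is not connected, $\mathrm{cd}(M)$ is the maximum contraction-depth of a component of $M$; otherwise $\mathrm{cd}(M)=1+\min_{e\in M}\mathrm{cd}(M/e)$. A contraction$^*$-decomposition of $M$ is a pair $(T,f)$, where $T$ is a rooted tree with exactly $\operatorname{rank}(M)$ edges and $f$ maps the elements of $M$ to leaves of $T$ (the root is a leaf only if it is the only vertex), such that for every set $X$ of elements of $M$ the smallest subtree of $T$ containing the root and all the vertices of $f(X)$ has at least $\operatorname{rank}(X)$ edges. The contraction$^*$-depth $\mathrm{csd}(M)$ is the minimum, over all contraction$^*$-decompositions $(T,f)$ of $M$, of the maximum number of edges on a path from the root to a leaf of $T$. **Theorem.** Let $M$ be a matroid. Call $M$ exceptional if every element of $M$ is a loop or a coloop and $M$ is not a non-empty matroid consisting solely of loops (that is, $M$ is empty, or it consists of loops and coloops only and has at least one coloop). If $M$ is not exceptional,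 then $$\mathrm{csd}(M)=\min_{M'}\mathrm{cd}(M')-1,$$ where the minimum is over all matroids $M'$ that contain $M$ as a restriction (up to isomorphism), and it is attained. If $M$ is exceptional, then $\mathrm{csd}(M)=\mathrm{cd}(M)\in\{0,1\}$. -/

import Mathlib

universe u v

namespace Matroid

/-- A matroid is connected if every two distinct elements lie in a common circuit. -/
def IsConn {α : Type*} (M : Matroid α) : Prop :=
  ∀ e ∈ M.E, ∀ f ∈ M.E, e ≠ f → ∃ C, M.IsCircuit C ∧ e ∈ C ∧ f ∈ C

/-- `C` is (the ground set of) a component of `M`: an inclusion-wise maximal set of elements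
such that the restriction of `M` to it is connected. -/
def IsComponent {α : Type*} (M : Matroid α) (C : Set α) : Prop :=
  Maximal (fun X : Set α => X ⊆ M.E ∧ (M ↾ X).IsConn) C

/-- The contraction-depth of a finite matroid. -/
noncomputable def contractionDepth {α : Type*} (M : Matroid α) [hM : M.Finite] : ℕ :=
  open Classical in
  if M.E = ∅ then 0
  else if M.E.ncard = 1 then 1
  else if h : M.IsConn then
    1 + ⨅ e : M.E, contractionDepth (M ／ {(e : α)})
  else
    ⨆ C : {C : Set α // M.IsComponent C},
      contractionDepth (M ↾ (C : Set α))
        (hM := restrict_finite (M.ground_finite.subset C.2.prop.1))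
termination_by M.E.ncard
decreasing_by
  · exact Set.ncard_lt_ncard ⟨Set.sdiff_subset, fun hs => (hs e.2).2 rfl⟩ M.ground_finite
  · refine Set.ncard_lt_ncard (C.2.prop.1.ssubset_of_ne fun hC => h ?_) M.ground_finite
    have h2 := C.2.prop.2
    rwa [hC, restrict_ground_eq_self] at h2

end Matroid

/-- In a rooted tree, given as the order of its vertices in which the root is the bottom element
and `u ≤ v` means that `u` lies on the path from `v` to the root, every edge joins a non-root
vertex to its parent and is identified here with that non-root vertex. This is the set of edges
of the smallest subtree that contains the root and all the vertices of `A`. -/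
def RootedTree.closureEdges (T : RootedTree) (A : Set T) : Set T :=
  {v | v ≠ ⊥ ∧ ∃ a ∈ A, v ≤ a}

/-- The depth of a (finite) rooted tree: the maximum number of edges on a path that starts at
the root. -/
noncomputable def RootedTree.depth (T : RootedTree) : ℕ :=
  ⨆ v : T, (T.closureEdges {v}).ncard

namespace Matroid

/-- `(T, f)` is a contraction-star-decomposition of `M`: the finite rooted tree `T` has
`rank M` edges, `f` maps the elements of `M` to leaves of `T`, and for every set `X` of elements
of `M` the smallest subtree that contains the root and `f '' X` has at least `rank X` edges.
(The values of `f` outside the ground set of `M` are irrelevant.) -/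
structure IsContractionStarDecomposition {α : Type*} (M : Matroid α) (T : RootedTree)
    (f : α → T) : Prop where
  finite_tree : Finite T
  card_edges : {v : T | v ≠ ⊥}.encard = M.eRank
  isLeaf : ∀ e ∈ M.E, IsMax (f e)
  rank_le : ∀ X ⊆ M.E, M.eRk X ≤ (T.closureEdges (f '' X)).encard

/-- The contraction-star-depth of a finite matroid: the minimum depth of a
contraction-star-decomposition. -/
noncomputable def contractionStarDepth {α : Type*} (M : Matroid α) : ℕ :=
  sInf {d : ℕ | ∃ (T : RootedTree.{0}) (f : α → T),
    M.IsContractionStarDecomposition T f ∧ T.depth = d}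

/-- `N` contains (an isomorphic copy of) `M` as a restriction. -/
def IsExtendedBy {α β : Type*} (M : Matroid α) (N : Matroid β) : Prop :=
  ∃ (f : α → β) (hf : Set.InjOn f M.E), M.map f hf ≤r N

/-- The exceptional matroids: every element is a loop or a coloop, but the matroid is not a
non-empty matroid that consists solely of loops. -/
def IsExceptional {α : Type*} (M : Matroid α) : Prop :=
  (∀ e ∈ M.E, M.IsLoop e ∨ M.IsColoop e) ∧ ¬ (M.E.Nonempty ∧ ∀ e ∈ M.E, M.IsLoop e)

end Matroid

/-! Two inequalities are proved. The lower bound on contraction-depth builds a tree for every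
restriction `N ↾ X` along the recursion that computes the depth of `N`
(`exists_isPathDecomposition_restrict`). If `N` is connected, let `e` be an optimal element to
contract. If `e` is spanned by `X`, the tree for `N ／ {e}` is hung below a new root edge; otherwise
contracting `e` does not change `N ↾ X`. If `N` is disconnected, trees of the parts are glued at the
root. Paths come out shorter than the contraction-depth, except that a coloop may need a path of
length one. For non-exceptional `M` this exception is harmless.

The upper bound turns an optimal tree of depth `d` into an extension of depth at most `d + 1`
(`IsTreeDecomposition.exists_extension`). The root-to-leaf paths form a tree-like family of sets. A
branching splits the ground set into `A` and `M.E \ A`, whose paths share only the core, of size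
`k`. If the rank of a side is less than the number of edges it covers, submodularity allows a core
edge to be removed from the paths of that side (`exists_erase`). Otherwise `k` is exactly the
connectivity of `A`, and `M ／ (M.E \ A)` and `M ／ A` are decomposed by the paths without the core.
Extensions of these, of depth at most `d - k + 1`, have a direct sum whose restriction to `M.E` is a
quotient of `M` with rank drop at most `k`. Then `quotientLift` supplies an extension of `M` in
which contracting `k` new elements gives back that direct sum, so the depth is at most `(d - k + 1)
+ k`. -/

open Set

/-! ### Circuits, separating sets and components. -/

namespace Matroid

variable {α : Type*} {M N : Matroid α} {A C D X Y : Set α} {e f : α}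

/-- Intersecting circuits: any two elements of their union that are picked one from each circuit lie
in a common circuit. -/
lemma IsCircuit.exists_isCircuit_mem_mem [M.Finite] (hC : M.IsCircuit C) (hD : M.IsCircuit D)
    (hCD : (C ∩ D).Nonempty) (he : e ∈ C) (hf : f ∈ D) :
    ∃ K, M.IsCircuit K ∧ e ∈ K ∧ f ∈ K := by
  by_contra! hcon
  induction hn : (C ∪ D).ncard using Nat.strong_induction_on generalizing C D with
  | _ n ih =>
    obtain ⟨x, hxC, hxD⟩ := hCD
    have heD : e ∉ D := fun h => hcon D hD h hf
    have hfC : f ∉ C := fun h => hcon C hC he h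
    have hfin : (C ∪ D).Finite :=
      M.ground_finite.subset (union_subset hC.subset_ground hD.subset_ground)
    obtain ⟨C', hC's, hC', heC'⟩ := hC.strong_elimination hD hxC hxD he heD
    obtain ⟨D', hD's, hD', hfD'⟩ := hD.strong_elimination hC hxD hxC hf hfC
    have hC'u : C' ⊆ C ∪ D := hC's.trans sdiff_subset
    have hD'u : D' ⊆ C ∪ D := union_comm D C ▸ hD's.trans sdiff_subset
    have hxC' : x ∉ C' := fun h => (hC's h).2 rfl
    have hxD' : x ∉ D' := fun h => (hD's h).2 rfl
    obtain ⟨y, hyC', hyC⟩ : ∃ y ∈ C', y ∉ C := by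
      by_contra! h
      exact hxC' (hC'.eq_of_subset_isCircuit hC h ▸ hxC)
    obtain ⟨z, hzD', hzD⟩ : ∃ z ∈ D', z ∉ D := by
      by_contra! h
      exact hxD' (hD'.eq_of_subset_isCircuit hD h ▸ hxD)
    have hyD : y ∈ D := (hC'u hyC').resolve_left hyC
    have hzC : z ∈ C := (hD'u hzD').resolve_right hzD
    -- `C'` and `D` meet in `y`, so a smaller union would contradict the induction hypothesis.
    -- Equality forces `z ∈ C'`; then `C'` and `D'` meet, and their union is smaller because it
    -- misses `x`.
    have heq : C' ∪ D = C ∪ D := by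
      by_contra hne
      refine ih _ ?_ hC' hD ⟨y, hyC', hyD⟩ heC' hf rfl
      rw [← hn]
      exact ncard_lt_ncard ((union_subset hC'u subset_union_right).ssubset_of_ne hne) hfin
    have hzC' : z ∈ C' := (heq.symm ▸ (Or.inl hzC : z ∈ C ∪ D) : z ∈ C' ∪ D).resolve_right hzD
    refine ih _ ?_ hC' hD' ⟨z, hzC', hzD'⟩ heC' hfD' rfl
    rw [← hn]
    refine ncard_lt_ncard ⟨union_subset hC'u hD'u, fun h => ?_⟩ hfin
    exact (h (Or.inl hxC)).elim hxC' hxD'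

/-- A set of elements separates a matroid if every circuit that meets it is contained in it. -/
def Separates (M : Matroid α) (A : Set α) : Prop :=
  ∀ ⦃C⦄, M.IsCircuit C → (C ∩ A).Nonempty → C ⊆ A

lemma Separates.sdiff (h : M.Separates A) : M.Separates (M.E \ A) := by
  rintro C hC ⟨x, hxC, hxE, hxA⟩ y hy
  exact ⟨hC.subset_ground hy, fun hyA => hxA (h hC ⟨y, hy, hyA⟩ hxC)⟩

lemma IsConn.subset_of_separates (hX : (M ↾ X).IsConn) (hXE : X ⊆ M.E) (h : M.Separates A)
    (hXA : (X ∩ A).Nonempty) : X ⊆ A := by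
  obtain ⟨a, haX, haA⟩ := hXA
  intro x hx
  obtain rfl | hne := eq_or_ne a x
  · exact haA
  obtain ⟨C, hC, haC, hxC⟩ := hX a haX x hx hne
  exact h ((restrict_isCircuit_iff hXE).1 hC).1 ⟨a, haC, haA⟩ hxC

lemma isConn_of_subsingleton (h : M.E.Subsingleton) : M.IsConn :=
  fun _ he _ hf hne => (hne (h he hf)).elim

lemma IsConn.restrict_union_isCircuit [M.Finite] (hX : (M ↾ X).IsConn) (hXE : X ⊆ M.E)
    (hC : M.IsCircuit C) (hCX : (C ∩ X).Nonempty) : (M ↾ (X ∪ C)).IsConn := by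
  obtain ⟨x, hxC, hxX⟩ := hCX
  have hE : X ∪ C ⊆ M.E := union_subset hXE hC.subset_ground
  have : (M ↾ (X ∪ C)).Finite := restrict_finite (M.ground_finite.subset hE)
  have key : ∀ e ∈ X ∪ C, e ≠ x → ∃ K, (M ↾ (X ∪ C)).IsCircuit K ∧ e ∈ K ∧ x ∈ K := by
    rintro e (he | he) hne
    · obtain ⟨K, hK, heK, hxK⟩ := hX e he x hxX hne
      rw [restrict_isCircuit_iff hXE] at hK
      exact ⟨K, (restrict_isCircuit_iff hE).2 ⟨hK.1, hK.2.trans subset_union_left⟩, heK, hxK⟩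
    · exact ⟨C, (restrict_isCircuit_iff hE).2 ⟨hC, subset_union_right⟩, he, hxC⟩
  intro e he f hf hef
  obtain rfl | hex := eq_or_ne e x
  · obtain ⟨K, hK, h1, h2⟩ := key f hf hef.symm
    exact ⟨K, hK, h2, h1⟩
  obtain rfl | hfx := eq_or_ne f x
  · exact key e he hef
  obtain ⟨K, hK, h1, h2⟩ := key e he hex
  obtain ⟨L, hL, h3, h4⟩ := key f hf hfx
  exact hK.exists_isCircuit_mem_mem hL ⟨x, h2, h4⟩ h1 h3

lemma IsComponent.separates [M.Finite] (hA : M.IsComponent A) : M.Separates A := by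
  intro C hC hCA
  have h := hA.2 (y := A ∪ C) ⟨union_subset hA.1.1 hC.subset_ground,
    hA.1.2.restrict_union_isCircuit hA.1.1 hC hCA⟩ subset_union_left
  exact subset_union_right.trans h

lemma IsConn.exists_isComponent [M.Finite] (hX : (M ↾ X).IsConn) (hXE : X ⊆ M.E) :
    ∃ A, M.IsComponent A ∧ X ⊆ A := by
  obtain ⟨A, hXA, hA⟩ := (M.ground_finite.finite_subsets.subset
    (fun Y (hY : Y ⊆ M.E ∧ (M ↾ Y).IsConn) => hY.1)).exists_le_maximal (a := X) ⟨hXE, hX⟩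
  exact ⟨A, hA, hXA⟩

lemma exists_isComponent_mem [M.Finite] (he : e ∈ M.E) : ∃ A, M.IsComponent A ∧ e ∈ A := by
  obtain ⟨A, hA, h⟩ := (isConn_of_subsingleton (M := M ↾ {e}) (by simp)).exists_isComponent
    (by simpa using he)
  exact ⟨A, hA, h rfl⟩

lemma IsConn.isComponent_ground (hM : M.IsConn) : M.IsComponent M.E :=
  ⟨⟨Subset.rfl, by rwa [restrict_ground_eq_self]⟩, fun _ h _ => h.1⟩

lemma IsConn.eq_of_isComponent (hM : M.IsConn) (hA : M.IsComponent A) : A = M.E :=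
  hA.1.1.antisymm (hA.2 hM.isComponent_ground.1 hA.1.1)

/-- In a separating set, the components of the restriction are those of the whole matroid. -/
lemma Separates.isComponent_of_restrict (h : M.Separates A) (hAE : A ⊆ M.E)
    (hC : (M ↾ A).IsComponent C) (hne : C.Nonempty) : M.IsComponent C := by
  have hCA : C ⊆ A := hC.1.1
  refine ⟨⟨hCA.trans hAE, ?_⟩, fun Y hY hCY => ?_⟩
  · simpa [restrict_restrict_eq M hCA] using hC.1.2
  · have hYA : Y ⊆ A := hY.2.subset_of_separates hY.1 h
      (hne.mono fun x hx => ⟨hCY hx, hCA hx⟩)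
    exact hC.2 ⟨hYA, by simpa [restrict_restrict_eq M hYA] using hY.2⟩ hCY

lemma IsComponent.restrict (hC : M.IsComponent C) (hCA : C ⊆ A) (hAE : A ⊆ M.E) :
    (M ↾ A).IsComponent C := by
  refine ⟨⟨hCA, by simpa [restrict_restrict_eq M hCA] using hC.1.2⟩, fun Y hY hCY => ?_⟩
  have hYA : Y ⊆ A := hY.1
  exact hC.2 ⟨hYA.trans hAE, by simpa [restrict_restrict_eq M hYA] using hY.2⟩ hCY

/-! ### Contraction-depth -/

lemma contractionDepth_congr [M.Finite] [N.Finite] (h : M = N) :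
    M.contractionDepth = N.contractionDepth := by
  subst h; rfl

lemma contractionDepth_of_ground_eq_empty [M.Finite] (h : M.E = ∅) : M.contractionDepth = 0 := by
  rw [contractionDepth, if_pos h]

lemma contractionDepth_of_ncard_eq_one [M.Finite] (h : M.E.ncard = 1) :
    M.contractionDepth = 1 := by
  rw [contractionDepth, if_neg, if_pos h]
  rintro h'
  simp [h'] at h

lemma contractionDepth_of_subsingleton [M.Finite] (h : M.E.Subsingleton) :
    M.contractionDepth ≤ 1 := by
  obtain h | ⟨x, h⟩ := h.eq_empty_or_singleton
  · simp [contractionDepth_of_ground_eq_empty h]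
  · rw [contractionDepth_of_ncard_eq_one (by simp [h])]

lemma IsConn.contractionDepth_eq [M.Finite] (hM : M.IsConn) (h : 2 ≤ M.E.ncard) :
    M.contractionDepth = 1 + ⨅ e : M.E, contractionDepth (M ／ {(e : α)}) := by
  rw [contractionDepth, if_neg, if_neg (by omega), dif_pos hM]
  rintro h'
  simp [h'] at h

lemma IsConn.contractionDepth_le [M.Finite] (hM : M.IsConn) (h : 2 ≤ M.E.ncard) (he : e ∈ M.E) :
    M.contractionDepth ≤ 1 + (M ／ {e}).contractionDepth := by
  rw [hM.contractionDepth_eq h]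
  exact Nat.add_le_add_left (ciInf_le (OrderBot.bddBelow _) (⟨e, he⟩ : M.E)) 1

lemma IsConn.exists_contractionDepth_eq [M.Finite] (hM : M.IsConn) (h : 2 ≤ M.E.ncard) :
    ∃ e ∈ M.E, M.contractionDepth = 1 + (M ／ {e}).contractionDepth := by
  rw [hM.contractionDepth_eq h]
  have : Nonempty M.E := (nonempty_of_ncard_ne_zero (by omega)).to_subtype
  obtain ⟨e, he⟩ := Nat.sInf_mem (range_nonempty fun e : M.E => (M ／ {(e : α)}).contractionDepth)
  exact ⟨e, e.2, by rw [iInf, ← he]⟩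

lemma contractionDepth_of_not_isConn [M.Finite] (hM : ¬ M.IsConn) :
    M.contractionDepth = ⨆ C : {C : Set α // M.IsComponent C},
      contractionDepth (M ↾ (C : Set α))
        (hM := restrict_finite (M.ground_finite.subset C.2.prop.1)) := by
  rw [contractionDepth, if_neg, if_neg, dif_neg hM]
  · intro h
    exact hM (isConn_of_subsingleton (fun a ha b hb => ncard_le_one M.ground_finite |>.1 h.le a ha b hb))
  · intro h
    exact hM (isConn_of_subsingleton (by simp [h]))

lemma IsComponent.contractionDepth_le [M.Finite] [(M ↾ C).Finite] (hC : M.IsComponent C) :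
    (M ↾ C).contractionDepth ≤ M.contractionDepth := by
  by_cases hM : M.IsConn
  · exact (contractionDepth_congr (by rw [hM.eq_of_isComponent hC, restrict_ground_eq_self])).le
  rw [contractionDepth_of_not_isConn hM]
  have : Finite {C : Set α // M.IsComponent C} :=
    (M.ground_finite.finite_subsets.subset fun Y (hY : M.IsComponent Y) => hY.1.1).to_subtype
  exact le_ciSup (f := fun C : {C : Set α // M.IsComponent C} => contractionDepth (M ↾ (C : Set α))
        (hM := restrict_finite (M.ground_finite.subset C.2.prop.1))) (finite_range _).bddAbove ⟨C, hC⟩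

lemma contractionDepth_le_of_forall_isComponent [M.Finite] {d : ℕ}
    (h : ∀ C, M.IsComponent C → ∀ [(M ↾ C).Finite], (M ↾ C).contractionDepth ≤ d) :
    M.contractionDepth ≤ d := by
  by_cases hM : M.IsConn
  · have : (M ↾ M.E).Finite := by rwa [restrict_ground_eq_self]
    rw [← contractionDepth_congr (restrict_ground_eq_self M)]
    exact h _ hM.isComponent_ground
  rw [contractionDepth_of_not_isConn hM]
  refine ciSup_le' fun C => ?_
  have : (M ↾ (C : Set α)).Finite := restrict_finite (M.ground_finite.subset C.2.prop.1)
  exact h C C.2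

lemma Separates.contractionDepth_restrict_le [M.Finite] [(M ↾ A).Finite] (h : M.Separates A)
    (hAE : A ⊆ M.E) : (M ↾ A).contractionDepth ≤ M.contractionDepth := by
  refine contractionDepth_le_of_forall_isComponent fun C hC _ => ?_
  obtain rfl | hne := C.eq_empty_or_nonempty
  · rw [contractionDepth_of_ground_eq_empty (by simp)]
    exact Nat.zero_le _
  have h' := h.isComponent_of_restrict hAE hC hne
  have heq : M ↾ A ↾ C = M ↾ C := restrict_restrict_eq M hC.1.1
  have : (M ↾ C).Finite := by rwa [← heq]
  rw [contractionDepth_congr heq]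
  exact h'.contractionDepth_le

lemma Separates.contractionDepth_le [M.Finite] [(M ↾ A).Finite] [(M ↾ (M.E \ A)).Finite]
    (h : M.Separates A) (hAE : A ⊆ M.E) {d : ℕ} (h₁ : (M ↾ A).contractionDepth ≤ d)
    (h₂ : (M ↾ (M.E \ A)).contractionDepth ≤ d) : M.contractionDepth ≤ d := by
  refine contractionDepth_le_of_forall_isComponent fun C hC _ => ?_
  have aux : ∀ B ⊆ M.E, C ⊆ B → ∀ [(M ↾ B).Finite], (M ↾ B).contractionDepth ≤ d →
      (M ↾ C).contractionDepth ≤ d := by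
    intro B hB hCB _ hd
    have heq := restrict_restrict_eq M hCB
    have : (M ↾ B ↾ C).Finite := by rwa [heq]
    rw [← contractionDepth_congr heq]
    exact (hC.restrict hCB hB).contractionDepth_le.trans hd
  by_cases hCA : (C ∩ A).Nonempty
  · exact aux A hAE (hC.1.2.subset_of_separates hC.1.1 h hCA) h₁
  · refine aux (M.E \ A) sdiff_subset (fun x hx => ⟨hC.1.1 hx, fun hxA => hCA ⟨x, hx, hxA⟩⟩) h₂

/-- For a nonloop `e` and an independent `I ⊆ A`, a circuit in `insert e I` would contain `e` and
also meet `A`, hence lie in `A`. Contracting a loop is deleting it. -/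
lemma Separates.restrict_contract_eq (h : M.Separates A) (heA : e ∉ A) :
    (M ／ {e}) ↾ A = M ↾ A := by
  by_cases he : e ∈ M.E
  swap
  · rw [contractElem_eq_self he]
  obtain hl | hnl := M.isLoop_or_isNonloop e
  · refine ext_indep rfl fun I (hI : I ⊆ A) => ?_
    rw [contract_eq_delete_of_subset_loops (singleton_subset_iff.2 hl)]
    simp only [restrict_indep_iff, delete_indep_iff, disjoint_singleton_right]
    exact ⟨fun h => ⟨h.1.1, h.2⟩, fun h => ⟨⟨h.1, fun h' => heA (hI h')⟩, h.2⟩⟩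
  refine ext_indep rfl fun I (hI : I ⊆ A) => ?_
  simp only [restrict_indep_iff, hnl.contractElem_indep_iff]
  refine ⟨fun h => ⟨h.1.2.subset (subset_insert _ _), h.2⟩, fun hI' => ⟨⟨fun h' => heA (hI h'), ?_⟩,
    hI⟩⟩
  by_contra hdep
  obtain ⟨C, hCI, hC⟩ := ((not_indep_iff (insert_subset he hI'.1.subset_ground)).1
    hdep).exists_isCircuit_subset
  have heC : e ∈ C := by
    by_contra heC
    exact hC.not_indep (hI'.1.subset ((subset_insert_iff_of_notMem heC).1 hCI))
  have hCe : C ≠ {e} := by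
    rintro rfl
    exact hC.not_indep (indep_singleton.2 hnl)
  obtain ⟨x, hx, hxe⟩ : ∃ x ∈ C, x ≠ e := by
    by_contra! hall
    exact hCe (eq_singleton_iff_unique_mem.2 ⟨heC, hall⟩)
  exact heA (h hC ⟨x, hx, hI ((hCI hx).resolve_left hxe)⟩ heC)

lemma Separates.contract (h : M.Separates A) (e : α) : (M ／ {e}).Separates (A \ {e}) := by
  rintro C hC ⟨x, hxC, hxA, -⟩
  obtain ⟨K, hK, hCK, -⟩ := hC.exists_subset_isCircuit_of_contract
  exact fun y hy => ⟨h hK ⟨x, hCK hxC, hxA⟩ (hCK hy), (hC.subset_ground hy).2⟩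

/-- The recursion gives this only for connected matroids. In general, only the component containing
`e` is affected by the contraction, and what is left of each component still separates `M ／ {e}`. -/
lemma contractionDepth_le_contract_add_one [M.Finite] (e : α) :
    M.contractionDepth ≤ (M ／ {e}).contractionDepth + 1 := by
  by_cases he : e ∈ M.E
  swap
  · rw [contractionDepth_congr (contractElem_eq_self he)]
    omega
  refine contractionDepth_le_of_forall_isComponent fun C hC hfin => ?_
  have hsep := hC.separates.contract e
  have hCE : C \ {e} ⊆ (M ／ {e}).E := sdiff_subset_sdiff_left hC.1.1
  by_cases heC : e ∈ C
  · by_cases hcard : C.ncard ≤ 1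
    · exact (contractionDepth_of_subsingleton
        (fun a ha b hb => ncard_le_one hfin.1 |>.1 hcard a ha b hb)).trans (by omega)
    have h1 := hC.1.2.contractionDepth_le (by simpa using by omega) (e := e) (by simpa)
    have heq := M.restrict_contract_eq_contract_restrict (singleton_subset_iff.2 heC)
    have : ((M ／ {e}) ↾ (C \ {e})).Finite := heq ▸ inferInstance
    rw [contractionDepth_congr heq] at h1
    have := hsep.contractionDepth_restrict_le hCE
    omega
  · rw [sdiff_singleton_eq_self heC] at hsep hCE
    have heq := hC.separates.restrict_contract_eq heC
    have : ((M ／ {e}) ↾ C).Finite := heq ▸ inferInstance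
    rw [← contractionDepth_congr heq]
    have := hsep.contractionDepth_restrict_le hCE
    omega

lemma contractionDepth_le_contract_add_ncard [M.Finite] {S : Set α} (hS : S.Finite) :
    M.contractionDepth ≤ (M ／ S).contractionDepth + S.ncard := by
  induction S, hS using Set.Finite.induction_on with
  | empty => rw [contractionDepth_congr (contract_empty M)]; omega
  | @insert a S ha hS ih =>
    have h1 := (M ／ S).contractionDepth_le_contract_add_one a
    rw [contractionDepth_congr ((M.contract_contract S {a}).trans
      (by rw [union_singleton] : M ／ (S ∪ {a}) = M ／ (insert a S)))] at h1
    rw [ncard_insert_of_notMem ha hS]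
    omega

lemma one_le_contractionDepth [M.Finite] (h : M.E.Nonempty) : 1 ≤ M.contractionDepth := by
  induction hn : M.E.ncard using Nat.strong_induction_on generalizing M with
  | _ n ih =>
    by_cases h1 : M.E.ncard ≤ 1
    · have := (ncard_pos M.ground_finite).2 h
      rw [contractionDepth_of_ncard_eq_one (by omega)]
    by_cases hM : M.IsConn
    · rw [hM.contractionDepth_eq (by omega)]
      omega
    obtain ⟨e, he⟩ := h
    obtain ⟨C, hC, heC⟩ := M.exists_isComponent_mem he
    have : (M ↾ C).Finite := restrict_finite (M.ground_finite.subset hC.1.1)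
    refine (ih _ ?_ ⟨e, heC⟩ rfl).trans hC.contractionDepth_le
    rw [← hn]
    refine ncard_lt_ncard (hC.1.1.ssubset_of_ne fun heq => hM ?_) M.ground_finite
    have := hC.1.2
    rwa [show C = M.E from heq, restrict_ground_eq_self] at this

/-- In a matroid of contraction-depth at most one, every element is a loop or a coloop. -/
lemma isLoop_or_isColoop_of_contractionDepth_le_one [M.Finite] (h : M.contractionDepth ≤ 1)
    (he : e ∈ M.E) : M.IsLoop e ∨ M.IsColoop e := by
  obtain ⟨C, hC, heC⟩ := M.exists_isComponent_mem he
  have hfin : (M ↾ C).Finite := restrict_finite (M.ground_finite.subset hC.1.1)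
  -- A component with two elements has depth one plus that of a non-empty contraction, hence at
  -- least two.
  have hCe : ∀ x ∈ C, x = e := by
    by_contra! hx
    obtain ⟨x, hxC, hxe⟩ := hx
    have hcard : 2 ≤ C.ncard := (one_lt_ncard hfin.1).2 ⟨x, hxC, e, heC, hxe⟩
    obtain ⟨f, hf, hdf⟩ := hC.1.2.exists_contractionDepth_eq (by simpa using hcard)
    have hpos : 1 ≤ ((M ↾ C) ／ {f}).contractionDepth := by
      refine one_le_contractionDepth ?_
      obtain ⟨y, hy, hyf⟩ := exists_ne_of_one_lt_ncard hcard f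
      exact ⟨y, hy, hyf⟩
    have := hC.contractionDepth_le
    omega
  by_cases hl : M.IsLoop e
  · exact Or.inl hl
  refine Or.inr ((isColoop_iff_forall_notMem_isCircuit he).2 fun K hK heK => hl ?_)
  have hKC := hC.separates hK ⟨e, heK, heC⟩
  rw [← singleton_isCircuit, ← (eq_singleton_iff_unique_mem.2 ⟨heK, fun x hx => hCe x (hKC hx)⟩ :
    K = {e})]
  exact hK

lemma contractionDepth_le_one_of_forall [M.Finite] (h : ∀ e ∈ M.E, M.IsLoop e ∨ M.IsColoop e) :
    M.contractionDepth ≤ 1 := by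
  refine contractionDepth_le_of_forall_isComponent fun C hC hfin => ?_
  refine contractionDepth_of_subsingleton fun a ha b hb => ?_
  by_contra hne
  obtain ⟨K, hK, haK, hbK⟩ := hC.1.2 a ha b hb hne
  replace hK := ((restrict_isCircuit_iff hC.1.1).1 hK).1
  obtain hl | hl := h a (hC.1.1 ha)
  · rw [hl.eq_of_isCircuit_mem hK haK] at hbK
    exact hne hbK.symm
  · exact hl.notMem_isCircuit hK haK

end Matroid

/-! ### Rank under contraction and separation. -/

namespace Matroid

variable {α β : Type*} {M N : Matroid α} {A C D X Y : Set α} {e f : α} {p : α → List ℕ}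

lemma eRk_contract_add_eRk (M : Matroid α) (C X : Set α) :
    (M ／ C).eRk X + M.eRk C = M.eRk (X ∪ C) := by
  obtain ⟨J, hJ⟩ := M.exists_isBasis' C
  obtain ⟨I, hI, hJI⟩ := hJ.indep.subset_isBasis'_of_subset
    (hJ.subset.trans (subset_union_right (s := X)))
  have hIC : J = I ∩ C := hJ.eq_of_subset_indep (hI.indep.subset inter_subset_left)
    (subset_inter hJI hJ.subset) inter_subset_right
  have h := hI.contract_isBasis' hJ
    (hI.indep.subset (union_subset sdiff_subset hJI))
  have hX : (M ／ C).eRk X = (M ／ C).eRk ((X ∪ C) \ C) := by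
    rw [← eRk_inter_ground, ← eRk_inter_ground (X := (X ∪ C) \ C)]
    congr 1
    ext x
    simp only [contract_ground, mem_inter_iff, mem_sdiff, mem_union]
    tauto
  rw [hX, ← h.encard_eq_eRk, ← hI.encard_eq_eRk, ← hJ.encard_eq_eRk, hIC,
    encard_sdiff_add_encard_inter]

/-- No circuit crosses between `A` and its complement, so bases of the two traces of `X` have an
independent union. -/
lemma Separates.eRk_add_le (h : M.Separates A) (X : Set α) :
    M.eRk (X ∩ A) + M.eRk (X \ A) ≤ M.eRk X := by
  obtain ⟨I, hI⟩ := M.exists_isBasis' (X ∩ A)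
  obtain ⟨J, hJ⟩ := M.exists_isBasis' (X \ A)
  have hdisj : Disjoint I J := (disjoint_sdiff_right.mono (hI.subset.trans inter_subset_right)
    hJ.subset)
  rw [← hI.encard_eq_eRk, ← hJ.encard_eq_eRk, ← encard_union_eq hdisj]
  refine Indep.encard_le_eRk_of_subset ?_
    (union_subset (hI.subset.trans inter_subset_left) (hJ.subset.trans sdiff_subset))
  rw [indep_iff_forall_subset_not_isCircuit
    (union_subset hI.indep.subset_ground hJ.indep.subset_ground)]
  intro K hKIJ hK
  by_cases hKA : (K ∩ A).Nonempty
  · refine hK.not_indep (hI.indep.subset fun x hx => ?_)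
    exact (hKIJ hx).resolve_right fun hxJ => (hJ.subset hxJ).2 (h hK hKA hx)
  · refine hK.not_indep (hJ.indep.subset fun x hx => ?_)
    exact (hKIJ hx).resolve_left fun hxI => hKA ⟨x, hx, (hI.subset hxI).2⟩

lemma Separates.isColoop_restrict (h : M.Separates A) (hX : X ⊆ M.E)
    (he : (M ↾ (X ∩ A)).IsColoop e) : (M ↾ X).IsColoop e := by
  have heE : e ∈ X ∩ A := he.mem_ground
  refine (isColoop_iff_forall_notMem_isCircuit heE.1).2 fun K hK heK => ?_
  rw [restrict_isCircuit_iff hX] at hK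
  refine he.notMem_isCircuit ((restrict_isCircuit_iff (inter_subset_left.trans hX)).2
    ⟨hK.1, subset_inter hK.2 (h hK.1 ⟨e, heK, heE.2⟩)⟩) heK

/-! ### Decompositions given by root-to-leaf paths -/

/-- The non-empty prefixes of the words `p x`, `x ∈ X`. -/
def prefixSet (p : α → List ℕ) (X : Set α) : Set (List ℕ) :=
  {l | l ≠ [] ∧ ∃ x ∈ X, l <+: p x}

/-- The words `p e` encode a rooted tree with `rank M` edges, namely their non-empty prefixes, such
that every set `X` spans at least `rank X` of them. -/
structure IsPathDecomposition (M : Matroid α) (p : α → List ℕ) : Prop where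
  rank_le : ∀ X ⊆ M.E, M.eRk X ≤ (prefixSet p X).encard
  card_le : (prefixSet p M.E).encard ≤ M.eRk M.E

lemma prefixSet_of_forall_eq_nil (h : ∀ x ∈ X, p x = []) : prefixSet p X = ∅ := by
  refine eq_empty_of_forall_notMem ?_
  rintro l ⟨hl, x, hx, hlx⟩
  rw [h x hx, List.prefix_nil] at hlx
  exact hl hlx

lemma isPathDecomposition_of_eRk_eq_zero (h : M.eRk M.E = 0) :
    M.IsPathDecomposition fun _ => [] where
  rank_le X hX := by
    have := M.eRk_mono hX
    rw [h] at this
    exact this.trans zero_le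
  card_le := by
    rw [prefixSet_of_forall_eq_nil (by simp)]
    simp

lemma prefixSet_const_zero (hX : X.Nonempty) : prefixSet (fun _ : α => [0]) X = {[0]} := by
  obtain ⟨x, hx⟩ := hX
  ext l
  simp only [prefixSet, mem_ofPred_eq, List.prefix_cons_iff, List.prefix_nil, mem_singleton_iff]
  constructor
  · rintro ⟨hl, -, -, rfl | ⟨t, rfl, rfl⟩⟩
    · exact (hl rfl).elim
    · rfl
  · rintro rfl
    exact ⟨by simp, x, hx, by simp⟩

/-- The tree of `q` is hung below a new root edge `[0]`, and `e` is placed at the lower end of that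
edge. -/
lemma prefixSet_eq_insert [DecidableEq α] {q : α → List ℕ} (hX : X.Nonempty) :
    prefixSet (fun x => if x = e then [0] else 0 :: q x) X =
      insert [0] ((0 :: ·) '' prefixSet q (X \ {e})) := by
  ext l
  simp only [prefixSet, mem_ofPred_eq, mem_insert_iff, mem_image, mem_sdiff, mem_singleton_iff]
  constructor
  · rintro ⟨hl, x, hx, hlx⟩
    split_ifs at hlx with hxe
    · obtain rfl | ⟨t, rfl, ht⟩ := List.prefix_cons_iff.1 hlx
      · exact (hl rfl).elim
      · rw [List.prefix_nil] at ht
        simp [ht]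
    · obtain rfl | ⟨t, rfl, ht⟩ := List.prefix_cons_iff.1 hlx
      · exact (hl rfl).elim
      · obtain rfl | hne := eq_or_ne t []
        · simp
        · exact Or.inr ⟨t, ⟨hne, x, ⟨hx, hxe⟩, ht⟩, rfl⟩
  · rintro (rfl | ⟨t, ⟨-, x, ⟨hx, hxe⟩, ht⟩, rfl⟩)
    · obtain ⟨x, hx⟩ := hX
      refine ⟨by simp, x, hx, ?_⟩
      split_ifs <;> simp
    · refine ⟨by simp, x, hx, ?_⟩
      rw [if_neg hxe]
      simpa using ht

lemma encard_prefixSet_insert [DecidableEq α] {q : α → List ℕ} (hX : X.Nonempty) :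
    (prefixSet (fun x => if x = e then [0] else 0 :: q x) X).encard =
      (prefixSet q (X \ {e})).encard + 1 := by
  rw [prefixSet_eq_insert hX, encard_insert_of_notMem, InjOn.encard_image]
  · exact fun _ _ _ _ h => (List.cons.inj h).2
  · rintro ⟨t, ht, h⟩
    exact ht.1 (List.cons.inj h).2

/-- Two trees are glued at the root; even and odd letters keep their edges apart. -/
lemma prefixSet_ite [DecidablePred (· ∈ A)] {q r : α → List ℕ} :
    prefixSet (fun x => if x ∈ A then (q x).map (2 * ·) else (r x).map (2 * · + 1)) X =
      List.map (2 * ·) '' prefixSet q (X ∩ A) ∪ List.map (2 * · + 1) '' prefixSet r (X \ A) := by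
  ext l
  simp only [prefixSet, mem_ofPred_eq, mem_union, mem_image, mem_sdiff, mem_inter_iff]
  constructor
  · rintro ⟨hl, x, hx, hlx⟩
    split_ifs at hlx with hxA
    · obtain ⟨t, ht, rfl⟩ := List.prefix_map_iff.1 hlx
      exact Or.inl ⟨t, ⟨by rintro rfl; simp at hl, x, ⟨hx, hxA⟩, ht⟩, rfl⟩
    · obtain ⟨t, ht, rfl⟩ := List.prefix_map_iff.1 hlx
      exact Or.inr ⟨t, ⟨by rintro rfl; simp at hl, x, ⟨hx, hxA⟩, ht⟩, rfl⟩
  · rintro (⟨t, ⟨hne, x, ⟨hx, hxA⟩, ht⟩, rfl⟩ | ⟨t, ⟨hne, x, ⟨hx, hxA⟩, ht⟩, rfl⟩)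
    · exact ⟨by simpa using hne, x, hx, by rw [if_pos hxA]; exact List.prefix_map_iff.2 ⟨t, ht, rfl⟩⟩
    · exact ⟨by simpa using hne, x, hx, by rw [if_neg hxA]; exact List.prefix_map_iff.2 ⟨t, ht, rfl⟩⟩

lemma encard_prefixSet_ite [DecidablePred (· ∈ A)] {q r : α → List ℕ} :
    (prefixSet (fun x => if x ∈ A then (q x).map (2 * ·) else (r x).map (2 * · + 1)) X).encard =
      (prefixSet q (X ∩ A)).encard + (prefixSet r (X \ A)).encard := by
  rw [prefixSet_ite, encard_union_eq, InjOn.encard_image, InjOn.encard_image]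
  · exact (List.map_injective_iff.2 fun a b h => by simpa using h).injOn
  · exact (List.map_injective_iff.2 fun a b h => by simpa using h).injOn
  · rw [Set.disjoint_left]
    rintro _ ⟨l, ⟨hl, -⟩, rfl⟩ ⟨m, ⟨hm, -⟩, h⟩
    obtain ⟨a, l, rfl⟩ := List.exists_cons_of_ne_nil hl
    obtain ⟨b, m, rfl⟩ := List.exists_cons_of_ne_nil hm
    have : 2 * b + 1 = 2 * a := (List.cons.inj h).1
    omega

lemma restrict_contract_eq_of_notMem_closure (he : e ∈ M.E) (heX : e ∉ M.closure X)
    (hX : X ⊆ M.E) : (M ／ {e}) ↾ X = M ↾ X := by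
  have heX' : e ∉ X := fun h => heX (M.subset_closure X hX h)
  have hnl : M.IsNonloop e := isNonloop_of_notMem_closure heX he
  refine ext_indep rfl fun I (hI : I ⊆ X) => ?_
  simp only [restrict_indep_iff, hnl.contractElem_indep_iff]
  refine ⟨fun h => ⟨h.1.2.subset (subset_insert _ _), h.2⟩, fun h => ⟨⟨fun h' => heX' (hI h'), ?_⟩,
    h.2⟩⟩
  exact h.1.insert_indep_iff.2 (Or.inl ⟨he, fun h' => heX (M.closure_mono hI h')⟩)

/-- Every restriction of `N` has a path decomposition that is shorter than the contraction-depth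
of `N` except for paths of length one to coloops. -/
theorem exists_isPathDecomposition_restrict [N.Finite] (hX : X ⊆ N.E) :
    ∃ p, (N ↾ X).IsPathDecomposition p ∧ ∀ x ∈ X, (p x).length + 1 ≤ N.contractionDepth ∨
      ((N ↾ X).IsColoop x ∧ (p x).length ≤ 1) := by
  classical
  induction hn : N.E.ncard using Nat.strong_induction_on generalizing N X with
  | _ n ih =>
    -- Rank zero is treated apart so that loops alone receive empty words. In the one-element case
    -- below, the element is then a coloop with a word of length one, the source of the second
    -- alternative.
    by_cases h0 : N.eRk X = 0
    · refine ⟨_, isPathDecomposition_of_eRk_eq_zero (by simpa [restrict_eRk_eq] using h0),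
        fun x hx => Or.inl ?_⟩
      simpa using one_le_contractionDepth ⟨x, hX hx⟩
    have hXne : X.Nonempty := by
      rw [nonempty_iff_ne_empty]
      rintro rfl
      simp at h0
    by_cases hN : N.IsConn
    · by_cases hcard : N.E.ncard ≤ 1
      · have hsub : X.Subsingleton := fun a ha b hb =>
          (ncard_le_one N.ground_finite).1 hcard a (hX ha) b (hX hb)
        refine ⟨fun _ => [0], ⟨fun Y hY => ?_, ?_⟩, fun x hx => Or.inr ⟨?_, by simp⟩⟩
        · obtain rfl | hYne := Y.eq_empty_or_nonempty
          · simp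
          rw [prefixSet_const_zero hYne, encard_singleton]
          exact (eRk_le_encard _ _).trans (encard_le_one_iff_subsingleton.2 (hsub.anti hY))
        · rw [restrict_ground_eq, prefixSet_const_zero hXne, encard_singleton,
            N.restrict_eRk_eq Subset.rfl]
          exact Order.one_le_iff_ne_zero.2 h0
        · have hXx : X = {x} := hsub.eq_singleton_of_mem hx
          refine (isColoop_iff_forall_notMem_isCircuit hx).2 fun K hK hxK => ?_
          have hKx : K = {x} := (hsub.anti hK.subset_ground).eq_singleton_of_mem hxK
          rw [restrict_isCircuit_iff hX, hKx, singleton_isCircuit] at hK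
          exact h0 (hXx ▸ hK.1.eRk_eq)
      · push Not at hcard
        obtain ⟨e, he, hde⟩ := hN.exists_contractionDepth_eq hcard
        have hne : (N ／ {e}).E.Nonempty := by
          obtain ⟨y, hy, hye⟩ := exists_ne_of_one_lt_ncard hcard e
          exact ⟨y, hy, hye⟩
        have hcirc : ∀ x ∈ N.E, x ≠ e → ∃ K, N.IsCircuit K ∧ x ∈ K ∧ e ∈ K :=
          fun x hx hxe => hN x hx e he hxe
        have hnl : N.IsNonloop e := by
          obtain ⟨y, hy, hye⟩ := hne
          obtain ⟨K, hK, hyK, heK⟩ := hcirc y hy hye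
          exact hK.isNonloop_of_mem ⟨y, hyK, e, heK, hye⟩ heK
        have hlt : (N ／ {e}).E.ncard < n := by
          rw [← hn]
          exact ncard_lt_ncard ⟨sdiff_subset, fun hs => (hs he).2 rfl⟩ N.ground_finite
        -- If `X` spans `e`, contracting `e` lowers the rank of `X` by exactly one, which pays for a
        -- new root edge. Otherwise contracting `e` leaves `N ↾ X` unchanged.
        by_cases hecl : e ∈ N.closure X
        · obtain ⟨q, hq, hlen⟩ := ih _ hlt (N := N ／ {e}) (X := X \ {e})
            (sdiff_subset_sdiff_left hX) rfl
          have hrk : ∀ Y, (N ／ {e}).eRk (Y \ {e}) + 1 = N.eRk (insert e Y) := by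
            intro Y
            rw [← hnl.eRk_eq, eRk_contract_add_eRk, sdiff_union_self, union_singleton]
          refine ⟨fun x => if x = e then [0] else 0 :: q x, ⟨fun Y hY => ?_, ?_⟩, fun x hx => ?_⟩
          · obtain rfl | hYne := Y.eq_empty_or_nonempty
            · simp
            replace hY : Y ⊆ X := hY
            rw [encard_prefixSet_insert hYne, N.restrict_eRk_eq hY]
            refine (N.eRk_mono (subset_insert e Y)).trans ?_
            rw [← hrk]
            have := hq.rank_le (Y \ {e}) (sdiff_subset_sdiff_left hY)
            rw [restrict_eRk_eq _ (sdiff_subset_sdiff_left hY)] at this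
            gcongr
          · rw [restrict_ground_eq, encard_prefixSet_insert hXne, N.restrict_eRk_eq Subset.rfl]
            have := hq.card_le
            rw [restrict_ground_eq, restrict_eRk_eq _ Subset.rfl] at this
            rw [← eRk_closure_eq, ← closure_insert_eq_of_mem_closure hecl, eRk_closure_eq, ← hrk]
            gcongr
          · have hpos := one_le_contractionDepth hne
            by_cases hxe : x = e
            · left
              simp only [hxe, if_pos, List.length_singleton]
              omega
            simp only [hxe, if_false, List.length_cons]
            obtain h | ⟨hco, hl⟩ := hlen x ⟨hx, hxe⟩
            · omega
            left
            -- The bound fails only if `N ／ {e}` has depth at most one, so that `x` is a loop or a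
            -- coloop there. A loop cannot be a coloop of the restriction, and a coloop of `N ／ {e}`
            -- is one of `N`, contrary to the circuit through `x` and `e`.
            by_contra hcon
            obtain ⟨K, hK, hxK, heK⟩ := hcirc x (hX hx) hxe
            obtain h | h := isLoop_or_isColoop_of_contractionDepth_le_one (M := N ／ {e})
              (by omega) (e := x) ⟨hX hx, hxe⟩
            · exact (restrict_isLoop_iff.2 ⟨⟨hx, hxe⟩, Or.inl h⟩ :
                ((N ／ {e}) ↾ (X \ {e})).IsLoop x).not_isColoop hco
            · exact (contract_isColoop_iff.1 h).1.notMem_isCircuit hK hxK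
        · have heX : e ∉ X := fun h => hecl (N.subset_closure X hX h)
          obtain ⟨p, hp, hlen⟩ := ih _ hlt (N := N ／ {e}) (X := X)
            (subset_sdiff_singleton hX heX) rfl
          rw [restrict_contract_eq_of_notMem_closure he hecl hX] at hp hlen
          exact ⟨p, hp, fun x hx => (hlen x hx).imp_left (by omega)⟩
    · obtain ⟨e, he⟩ := hXne.mono hX
      obtain ⟨C, hC, heC⟩ := N.exists_isComponent_mem he
      have hsep := hC.separates
      have hCE : C ⊆ N.E := hC.1.1
      have hfin₁ : (N ↾ C).Finite := restrict_finite (N.ground_finite.subset hCE)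
      have hfin₂ : (N ↾ (N.E \ C)).Finite := restrict_finite (N.ground_finite.subset sdiff_subset)
      have hlt₁ : (N ↾ C).E.ncard < n := by
        rw [← hn]
        refine ncard_lt_ncard (hCE.ssubset_of_ne fun heq => hN ?_) N.ground_finite
        have := hC.1.2
        rwa [show C = N.E from heq, restrict_ground_eq_self] at this
      have hlt₂ : (N ↾ (N.E \ C)).E.ncard < n := by
        rw [← hn]
        exact ncard_lt_ncard ⟨sdiff_subset, fun h => (h he).2 heC⟩ N.ground_finite
      obtain ⟨q, hq, hqlen⟩ := ih _ hlt₁ (N := N ↾ C) (X := X ∩ C) inter_subset_right rfl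
      obtain ⟨r, hr, hrlen⟩ := ih _ hlt₂ (N := N ↾ (N.E \ C)) (X := X \ C)
        (sdiff_subset_sdiff_left hX) rfl
      rw [restrict_restrict_eq N inter_subset_right] at hq hqlen
      rw [restrict_restrict_eq N (sdiff_subset_sdiff_left hX)] at hr hrlen
      refine ⟨fun x => if x ∈ C then (q x).map (2 * ·) else (r x).map (2 * · + 1),
        ⟨fun Y hY => ?_, ?_⟩, fun x hx => ?_⟩
      · replace hY : Y ⊆ X := hY
        rw [encard_prefixSet_ite, N.restrict_eRk_eq hY]
        have h1 := hq.rank_le (Y ∩ C) (inter_subset_inter_left C hY)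
        have h2 := hr.rank_le (Y \ C) (sdiff_subset_sdiff_left hY)
        rw [N.restrict_eRk_eq (inter_subset_inter_left C hY)] at h1
        rw [N.restrict_eRk_eq (sdiff_subset_sdiff_left hY)] at h2
        exact (N.eRk_le_eRk_inter_add_eRk_sdiff Y C).trans (add_le_add h1 h2)
      · rw [restrict_ground_eq, encard_prefixSet_ite, N.restrict_eRk_eq Subset.rfl]
        have h1 := hq.card_le
        have h2 := hr.card_le
        rw [restrict_ground_eq, N.restrict_eRk_eq Subset.rfl] at h1 h2
        exact (add_le_add h1 h2).trans (hsep.eRk_add_le X)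
      · have hle₁ := hsep.contractionDepth_restrict_le hCE
        have hle₂ := hsep.sdiff.contractionDepth_restrict_le sdiff_subset
        by_cases hxC : x ∈ C
        · simp only [hxC, if_true, List.length_map]
          obtain h | ⟨h, hl⟩ := hqlen x ⟨hx, hxC⟩
          · omega
          · exact Or.inr ⟨hsep.isColoop_restrict hX h, hl⟩
        · simp only [hxC, if_false, List.length_map]
          obtain h | ⟨h, hl⟩ := hrlen x ⟨hx, hxC⟩
          · omega
          · refine Or.inr ⟨hsep.sdiff.isColoop_restrict hX ?_, hl⟩
            rwa [← inter_sdiff_assoc, inter_eq_self_of_subset_left hX]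

end Matroid

/-! ### Rooted trees of words. -/

section

variable {ι : Type*}

/-- The longest common prefix of two words. -/
def List.commonPrefix [DecidableEq ι] : List ι → List ι → List ι
  | a :: l, b :: m => if a = b then a :: List.commonPrefix l m else []
  | _, _ => []

lemma List.prefix_commonPrefix_iff [DecidableEq ι] {k l m : List ι} :
    k <+: l.commonPrefix m ↔ k <+: l ∧ k <+: m := by
  induction l generalizing k m with
  | nil => simp +contextual [List.commonPrefix]
  | cons a l ih =>
    cases m with
    | nil => simp +contextual [List.commonPrefix]
    | cons b m =>
      by_cases hab : a = b
      · subst hab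
        cases k with
        | nil => simp
        | cons c k => simp [List.commonPrefix, ih]; tauto
      · cases k with
        | nil => simp
        | cons c k =>
          simp only [List.commonPrefix, if_neg hab, List.prefix_nil, List.cons_prefix_cons]
          simp only [reduceCtorEq, false_iff]
          rintro ⟨⟨rfl, -⟩, rfl, -⟩
          exact hab rfl

/-- The rooted tree whose vertices are the words in a prefix-closed set. -/
def RootedTree.ofPrefixClosed [DecidableEq ι] (S : Set (List ι)) (h0 : [] ∈ S)
    (hS : ∀ ⦃l m⦄, l <+: m → m ∈ S → l ∈ S) : RootedTree :=
  letI : SemilatticeInf S :=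
    { le := fun l m => l.1 <+: m.1
      le_refl := fun l => List.prefix_rfl
      le_trans := fun _ _ _ h h' => h.trans h'
      le_antisymm := fun _ _ h h' => Subtype.ext (List.IsPrefix.eq_of_length_le h (List.IsPrefix.length_le h'))
      inf := fun l m => ⟨l.1.commonPrefix m.1, hS (List.prefix_commonPrefix_iff.1 List.prefix_rfl).1 l.2⟩
      inf_le_left := fun l m => (List.prefix_commonPrefix_iff.1 List.prefix_rfl).1
      inf_le_right := fun l m => (List.prefix_commonPrefix_iff.1 List.prefix_rfl).2
      le_inf := fun k l m h h' => List.prefix_commonPrefix_iff.2 ⟨h, h'⟩ }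
  letI : OrderBot S :=
    { bot := ⟨[], h0⟩
      bot_le := fun l => List.nil_prefix }
  letI : PredOrder S :=
    { pred := fun l => ⟨l.1.dropLast, hS (List.dropLast_prefix _) l.2⟩
      pred_le := fun l => List.dropLast_prefix _
      min_of_le_pred := fun {l} h m _ => by
        have h1 := (show l.1 <+: l.1.dropLast from h).length_le
        rw [List.length_dropLast] at h1
        have h2 : l.1 = [] := by
          rw [← List.length_eq_zero_iff]
          omega
        show l.1 <+: m.1
        rw [h2]
        exact List.nil_prefix
      le_pred_of_lt := fun {l m} h => by
        have h1 : l.1 <+: m.1 := h.le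
        have h2 : ¬ m.1 <+: l.1 := fun h' => h.not_ge h'
        show l.1 <+: m.1.dropLast
        refine List.prefix_of_prefix_length_le h1 (List.dropLast_prefix _) ?_
        rw [List.length_dropLast]
        by_contra hlt
        refine h2 ?_
        rw [h1.eq_of_length_le (by omega)] }
  { α := S
    isPredArchimedean := ⟨fun {l m} h => by
      induction hn : m.1.length - l.1.length generalizing m with
      | zero =>
        refine ⟨0, ?_⟩
        have h1 : l.1 <+: m.1 := h
        exact Subtype.ext (h1.eq_of_length_le (by omega)).symm
      | succ n ih =>
        have hlt : l < m := by
          refine lt_of_le_of_ne h ?_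
          rintro rfl
          omega
        obtain ⟨k, hk⟩ := ih (Order.le_pred_of_lt hlt) (by
          show m.1.dropLast.length - l.1.length = n
          rw [List.length_dropLast]
          omega)
        exact ⟨k + 1, hk⟩⟩ }

namespace RootedTree

variable [DecidableEq ι] {S : Set (List ι)} (h0 : [] ∈ S) (hS : ∀ ⦃l m⦄, l <+: m → m ∈ S → l ∈ S)

/-- The words in `S`, as vertices of the tree. -/
def vertexOfMem (l : S) : ofPrefixClosed S h0 hS := l

/-- The word of a vertex. -/
def word (v : ofPrefixClosed S h0 hS) : List ι := Subtype.val (p := (· ∈ S)) v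

lemma word_injective : Function.Injective (word h0 hS) := Subtype.val_injective

lemma word_le_iff {v w : ofPrefixClosed S h0 hS} : v ≤ w ↔ word h0 hS v <+: word h0 hS w := Iff.rfl

lemma word_ne_nil_iff {v : ofPrefixClosed S h0 hS} : word h0 hS v ≠ [] ↔ v ≠ ⊥ :=
  not_congr ⟨fun h => Subtype.ext h, fun h => h ▸ rfl⟩

end RootedTree

/-! ### From path decompositions to rooted trees. -/

namespace Matroid

variable {α β : Type*} {M N : Matroid α} {A C D X Y : Set α} {e f : α} {p : α → List ℕ}

lemma finite_setOf_prefix (l : List ι) : {k | k <+: l}.Finite := by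
  classical
  exact (l.inits.toFinset.finite_toSet).subset fun k hk => by simpa using hk

lemma ncard_setOf_prefix_le (l : List ι) : {k | k ≠ [] ∧ k <+: l}.ncard ≤ l.length := by
  have h := ncard_le_ncard_of_injOn (s := {k | k ≠ [] ∧ k <+: l}) (t := Icc 1 l.length)
    List.length (fun k hk => ⟨List.length_pos_iff.2 hk.1, hk.2.length_le⟩) ?_ (finite_Icc _ _)
  · simpa [← Nat.card_coe_set_eq] using h
  · intro k hk m hm hkm
    exact (List.prefix_of_prefix_length_le hk.2 hm.2 hkm.le).eq_of_length hkm

/-- A path decomposition yields a contraction-star-decomposition whose depth is at most the maximum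
length of a path. -/
theorem IsPathDecomposition.exists_isContractionStarDecomposition [M.Finite]
    (h : M.IsPathDecomposition p) {d : ℕ} (hd : ∀ x ∈ M.E, (p x).length ≤ d) :
    ∃ (T : RootedTree.{0}) (f : α → T), M.IsContractionStarDecomposition T f ∧ T.depth ≤ d := by
  classical
  set S : Set (List ℕ) := insert [] (prefixSet p M.E) with hSdef
  have hpS : ∀ x ∈ M.E, ∀ l, l <+: p x → l ∈ S := by
    intro x hx l hl
    by_cases hl0 : l = []
    · exact Or.inl hl0
    · exact Or.inr ⟨hl0, x, hx, hl⟩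
  have h0 : [] ∈ S := mem_insert _ _
  have hS : ∀ ⦃l m⦄, l <+: m → m ∈ S → l ∈ S := by
    rintro l m hlm (rfl | ⟨-, x, hx, hm⟩)
    · rwa [List.prefix_nil.1 hlm]
    · exact hpS x hx l (hlm.trans hm)
  have hfin : S.Finite := by
    refine ((M.ground_finite.biUnion fun x _ => finite_setOf_prefix (p x)).subset ?_).insert []
    rintro l ⟨-, x, hx, hl⟩
    exact mem_biUnion hx hl
  let T := RootedTree.ofPrefixClosed S h0 hS
  let w : T → List ℕ := RootedTree.word h0 hS
  have hw : Function.Injective w := RootedTree.word_injective h0 hS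
  have hwle : ∀ {u v : T}, u ≤ v ↔ w u <+: w v := RootedTree.word_le_iff h0 hS
  have hwbot : ∀ {v : T}, w v ≠ [] ↔ v ≠ ⊥ := RootedTree.word_ne_nil_iff h0 hS
  have hwmem : ∀ v : T, w v ∈ S := fun v => Subtype.prop (p := (· ∈ S)) v
  have hwsurj : ∀ l ∈ S, ∃ v : T, w v = l := fun l hl => ⟨RootedTree.vertexOfMem h0 hS ⟨l, hl⟩, rfl⟩
  have hTfin : Finite T := hfin.to_subtype
  -- The word `p x` may be a proper prefix of another word. Moving `x` to a leaf above it only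
  -- enlarges the subtrees, and every leaf is still a prefix of some word, so the depth bound is
  -- kept.
  have hf : ∀ x, ∃ v : T, IsMax v ∧ (x ∈ M.E → p x <+: w v) := by
    intro x
    by_cases hx : x ∈ M.E
    · obtain ⟨u, hu⟩ := hwsurj (p x) (hpS x hx _ List.prefix_rfl)
      obtain ⟨v, huv, hv⟩ := Set.Finite.exists_le_maximal (s := (univ : Set T)) finite_univ
        (mem_univ u)
      exact ⟨v, fun b hb => hv.2 (mem_univ b) hb, fun _ => hu ▸ hwle.1 huv⟩
    · obtain ⟨v, -, hv⟩ := Set.Finite.exists_le_maximal (s := (univ : Set T)) finite_univ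
        (mem_univ ⊥)
      exact ⟨v, fun b hb => hv.2 (mem_univ b) hb, fun h => (hx h).elim⟩
  choose f hfmax hfp using hf
  refine ⟨T, f, ⟨hTfin, ?_, fun e _ => hfmax e, fun X hX => ?_⟩, ?_⟩
  · rw [← hw.encard_image, ← eRk_ground]
    have himage : w '' {v | v ≠ ⊥} = prefixSet p M.E := by
      ext l
      constructor
      · rintro ⟨v, hv, rfl⟩
        exact (hwmem v).resolve_left (hwbot.2 hv)
      · intro hl
        obtain ⟨v, rfl⟩ := hwsurj l (Or.inr hl)
        exact ⟨v, hwbot.1 hl.1, rfl⟩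
    rw [himage]
    exact h.card_le.antisymm (h.rank_le _ Subset.rfl)
  · refine (h.rank_le X hX).trans ?_
    rw [← hw.encard_image]
    refine encard_le_encard ?_
    rintro l ⟨hl, x, hx, hlx⟩
    obtain ⟨v, rfl⟩ := hwsurj l (hpS x (hX hx) l hlx)
    exact ⟨v, ⟨hwbot.1 hl, f x, mem_image_of_mem f hx, hwle.2 (hlx.trans (hfp x (hX hx)))⟩, rfl⟩
  · refine ciSup_le' fun v => ?_
    have key : ∀ l : List ℕ, l.length ≤ d → w v <+: l → (T.closureEdges {v}).ncard ≤ d := by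
      intro l hl hv
      rw [← ncard_image_of_injective _ hw]
      refine (ncard_le_ncard ?_ ((finite_setOf_prefix l).subset fun k hk => hk.2)).trans
        ((ncard_setOf_prefix_le l).trans hl)
      rintro _ ⟨u, ⟨hu, a, ha, hua⟩, rfl⟩
      have huv : u ≤ v := mem_singleton_iff.1 ha ▸ hua
      exact ⟨hwbot.2 hu, (hwle.1 huv).trans hv⟩
    obtain hv | ⟨-, x, hx, hv⟩ := hwmem v
    · exact key [] (by simp) (hv ▸ List.prefix_rfl)
    · exact key (p x) (hd x hx) hv

end Matroid

end

namespace Matroid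

variable {α β γ : Type*} {M N : Matroid β} {A C D I J S X Y : Set β} {e f : β}

/-! ### The natural-number valued rank function of a matroid of finite rank -/

/-- The rank of a set as a natural number (meaningful in matroids of finite rank). -/
noncomputable def natRk (M : Matroid β) (X : Set β) : ℕ := (M.eRk X).toNat

lemma coe_natRk [M.RankFinite] (X : Set β) : (M.natRk X : ℕ∞) = M.eRk X :=
  ENat.natCast_toNat (eRk_ne_top_iff.2 (M.isRkFinite_set X))

lemma natRk_mono [M.RankFinite] (h : X ⊆ Y) : M.natRk X ≤ M.natRk Y := by
  rw [← Nat.cast_le (α := ℕ∞), coe_natRk, coe_natRk]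
  exact M.eRk_mono h

lemma natRk_inter_add_natRk_union_le [M.RankFinite] (X Y : Set β) :
    M.natRk (X ∩ Y) + M.natRk (X ∪ Y) ≤ M.natRk X + M.natRk Y := by
  rw [← Nat.cast_le (α := ℕ∞)]
  push_cast [coe_natRk]
  exact M.eRk_inter_add_eRk_union_le X Y

lemma natRk_union_le [M.RankFinite] (X Y : Set β) :
    M.natRk (X ∪ Y) ≤ M.natRk X + M.natRk Y :=
  (Nat.le_add_left _ _).trans (natRk_inter_add_natRk_union_le X Y)

lemma natRk_le_ncard [M.RankFinite] (hX : X.Finite) : M.natRk X ≤ X.ncard := by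
  rw [← Nat.cast_le (α := ℕ∞), coe_natRk, hX.cast_ncard_eq]
  exact M.eRk_le_encard X

lemma natRk_empty : M.natRk ∅ = 0 := by simp [natRk]

lemma indep_iff_natRk_eq [M.RankFinite] (hI : I.Finite) : M.Indep I ↔ M.natRk I = I.ncard := by
  rw [indep_iff_eRk_eq_encard_of_finite hI, ← Nat.cast_inj (R := ℕ∞), coe_natRk,
    hI.cast_ncard_eq]

lemma natRk_contract_add_natRk [M.RankFinite] (C X : Set β) :
    (M ／ C).natRk X + M.natRk C = M.natRk (X ∪ C) := by
  rw [← Nat.cast_inj (R := ℕ∞)]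
  push_cast [coe_natRk]
  exact M.eRk_contract_add_eRk C X

lemma IsRestriction.natRk_eq (h : M ≤r N) (hX : X ⊆ M.E) : N.natRk X = M.natRk X := by
  obtain ⟨R, -, rfl⟩ := h
  rw [natRk, natRk, restrict_eRk_eq _ (show X ⊆ R from hX)]

lemma IsRestriction.closure_subset (h : M ≤r N) (X : Set β) : M.closure X ⊆ N.closure X := by
  obtain ⟨R, hR, rfl⟩ := h
  rw [restrict_closure_eq', sdiff_eq_empty.2 hR, union_empty]
  exact inter_subset_left.trans (N.closure_mono inter_subset_left)

/-! ### Simultaneous extension of a matroid and a lift of a quotient -/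

/-- If `M` is a matroid and the restriction of `N` to the ground set of `M` is a quotient of `M`,
then this matroid on `N.E ∪ S` extends `M`, and contracting `S` yields `N`, provided
that `|S|` is at least the rank drop of the quotient. -/
def quotientLift (M N : Matroid β) [N.Finite] (S : Set β) (hS : S.Finite)
    (hMN : ∀ X, M.closure X ⊆ N.closure X) : Matroid β :=
  (IndepMatroid.ofFinite (E := N.E ∪ S) (N.ground_finite.union hS)
    -- With new elements `S` regarded as loops added to `N`, the last condition allows nullity at
    -- most `|S|`: it is the elongation of that matroid by `|S|`.
    (fun I => I ⊆ N.E ∪ S ∧ M.Indep (I ∩ M.E) ∧ I.ncard ≤ N.natRk I + S.ncard)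
    (by simp)
    (by
      rintro I J ⟨hJE, hJM, hJN⟩ hIJ
      have hJfin := (N.ground_finite.union hS).subset hJE
      refine ⟨hIJ.trans hJE, hJM.subset (inter_subset_inter_left _ hIJ), ?_⟩
      have h1 := ncard_sdiff_add_ncard_of_subset hIJ hJfin
      have h2 : N.natRk J ≤ N.natRk I + (J \ I).ncard := by
        have := natRk_union_le (M := N) I (J \ I)
        rw [union_sdiff_cancel hIJ] at this
        exact this.trans (Nat.add_le_add_left (natRk_le_ncard (hJfin.subset sdiff_subset)) _)
      omega)
    (by
      rintro I J ⟨hIE, hIM, hIN⟩ ⟨hJE, hJM, hJN⟩ hIJ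
      have hIfin := (N.ground_finite.union hS).subset hIE
      have hJfin := (N.ground_finite.union hS).subset hJE
      -- An element that raises the `N`-rank of `I` keeps the nullity and, by the quotient
      -- hypothesis, is not in the `M`-closure of `I ∩ M.E`.
      by_cases hlt : N.natRk I < N.natRk J
      · rw [← Nat.cast_lt (α := ℕ∞), coe_natRk, coe_natRk] at hlt
        obtain ⟨y, ⟨hyJ, hyI⟩, hy⟩ := exists_eRk_insert_eq_add_one_of_lt hlt
        have hcard : N.natRk (insert y I) = N.natRk I + 1 := by
          rw [← Nat.cast_inj (R := ℕ∞)]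
          push_cast [coe_natRk]
          exact hy
        have hycl : y ∉ N.closure I := by
          intro hycl
          have := N.eRk_closure_eq (insert y I)
          rw [closure_insert_eq_of_mem_closure hycl, eRk_closure_eq, ← coe_natRk, ← coe_natRk,
            Nat.cast_inj] at this
          omega
        refine ⟨y, hyJ, hyI, insert_subset (hJE hyJ) hIE, ?_, ?_⟩
        · by_cases hyM : y ∈ M.E
          · rw [insert_inter_of_mem hyM]
            exact hIM.insert_indep_iff.2 (Or.inl ⟨hyM, fun h =>
              hycl (N.closure_mono inter_subset_left (hMN _ h))⟩)
          · rwa [insert_inter_of_notMem hyM]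
        · rw [hcard, ncard_insert_of_notMem hyI hIfin]
          omega
      -- Now `J` is larger than `I` without having larger rank, so the nullity of `I` is not maximal
      -- and any new element is allowed. Only independence in `M` matters.
      have hcard : ∀ y, y ∉ I → (insert y I).ncard ≤ N.natRk (insert y I) + S.ncard := by
        intro y hy
        rw [ncard_insert_of_notMem hy hIfin]
        have := natRk_mono (M := N) (subset_insert y I)
        omega
      by_cases hJI : ∃ y ∈ J, y ∉ I ∧ y ∉ M.E
      · obtain ⟨y, hyJ, hyI, hyM⟩ := hJI
        exact ⟨y, hyJ, hyI, insert_subset (hJE hyJ) hIE, by rwa [insert_inter_of_notMem hyM],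
          hcard y hyI⟩
      push Not at hJI
      have h1 := ncard_inter_add_ncard_sdiff_eq_ncard I M.E hIfin
      have h2 := ncard_inter_add_ncard_sdiff_eq_ncard J M.E hJfin
      have h3 : (J \ M.E).ncard ≤ (I \ M.E).ncard := by
        refine ncard_le_ncard (fun y hy => ⟨?_, hy.2⟩) (hIfin.subset sdiff_subset)
        by_contra hyI
        exact hy.2 (hJI y hy.1 hyI)
      obtain ⟨y, ⟨⟨hyJ, hyM⟩, hyI⟩, hy⟩ := hIM.augment hJM (by
        rw [← (hIfin.subset inter_subset_left).cast_ncard_eq,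
          ← (hJfin.subset inter_subset_left).cast_ncard_eq, Nat.cast_lt]
        omega)
      have hyI' : y ∉ I := fun h => hyI ⟨h, hyM⟩
      exact ⟨y, hyJ, hyI', insert_subset (hJE hyJ) hIE, by rwa [insert_inter_of_mem hyM],
        hcard y hyI'⟩)
    (fun I hI => hI.1)).matroid

section quotientLift

variable [N.Finite] {hS : S.Finite} {hMN : ∀ X, M.closure X ⊆ N.closure X}

lemma quotientLift_ground : (quotientLift M N S hS hMN).E = N.E ∪ S := rfl

lemma quotientLift_indep_iff : (quotientLift M N S hS hMN).Indep I ↔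
    I ⊆ N.E ∪ S ∧ M.Indep (I ∩ M.E) ∧ I.ncard ≤ N.natRk I + S.ncard := Iff.rfl

instance : (quotientLift M N S hS hMN).Finite := ⟨N.ground_finite.union hS⟩

lemma isRestriction_quotientLift (hE : M.E ⊆ N.E)
    (h : ∀ I, M.Indep I → I.ncard ≤ N.natRk I + S.ncard) : M ≤r quotientLift M N S hS hMN := by
  refine ⟨M.E, hE.trans subset_union_left, ext_indep rfl fun I hI => ?_⟩
  rw [restrict_indep_iff, quotientLift_indep_iff, inter_eq_self_of_subset_left hI]
  exact ⟨fun hi => ⟨⟨hI.trans (hE.trans subset_union_left), hi, h I hi⟩, hI⟩, fun hi => hi.1.2.1⟩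

/-- Adjoining `S` to `I ⊆ N.E` uses up the whole allowance `|S|`, leaving the condition that `I` is
independent in `N`. Independence in `M` then follows from the inclusion of closures. -/
lemma quotientLift_contract (hE : M.E ⊆ N.E) (hdisj : Disjoint N.E S) :
    quotientLift M N S hS hMN ／ S = N := by
  have hSM : S ∩ M.E = ∅ := (hdisj.mono_left hE).symm.inter_eq
  have hSi : (quotientLift M N S hS hMN).Indep S :=
    quotientLift_indep_iff.2 ⟨subset_union_right, by simp [hSM], Nat.le_add_left _ _⟩
  refine ext_indep ?_ fun I hI => ?_
  · rw [contract_ground, quotientLift_ground, union_sdiff_right, hdisj.sdiff_eq_left]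
  have hIN : I ⊆ N.E := by
    rwa [contract_ground, quotientLift_ground, union_sdiff_right, hdisj.sdiff_eq_left] at hI
  have hIfin := N.ground_finite.subset hIN
  have hIS : Disjoint I S := hdisj.mono_left hIN
  have hrk : N.natRk (I ∪ S) = N.natRk I := by
    rw [natRk, natRk, ← eRk_inter_ground, union_inter_distrib_right, hdisj.symm.inter_eq,
      union_empty, eRk_inter_ground]
  have hle := natRk_le_ncard (M := N) hIfin
  rw [hSi.contract_indep_iff, quotientLift_indep_iff, hrk, ncard_union_eq hIS hIfin hS,
    indep_iff_natRk_eq hIfin, union_inter_distrib_right, hSM, union_empty]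
  refine ⟨fun h => by omega, fun h => ⟨hIS, union_subset_union_left _ hIN, ?_, by omega⟩⟩
  have hi : N.Indep (I ∩ M.E) := ((indep_iff_natRk_eq hIfin).2 h).subset inter_subset_left
  rw [indep_iff_forall_notMem_closure_sdiff inter_subset_right]
  exact fun x hx hxcl => hi.notMem_closure_sdiff_of_mem hx (hMN _ hxcl)

end quotientLift

/-! ### Direct sums. -/

section disjointSum

variable {h : Disjoint M.E N.E}

lemma isRestriction_disjointSum_left : M ≤r M.disjointSum N h := by
  refine ⟨M.E, by simp, ext_indep rfl fun I hI => ?_⟩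
  have hIN : I ∩ N.E = ∅ := (h.mono_left hI).inter_eq
  simp only [restrict_indep_iff, disjointSum_indep_iff, hIN, inter_eq_self_of_subset_left hI,
    empty_indep, true_and]
  exact ⟨fun hi => ⟨⟨hi, hI.trans subset_union_left⟩, hI⟩, fun hi => hi.1.1⟩

lemma isRestriction_disjointSum_right : N ≤r M.disjointSum N h := by
  rw [disjointSum_comm]
  exact isRestriction_disjointSum_left

lemma separates_disjointSum : (M.disjointSum N h).Separates M.E := by
  rintro C hC ⟨x, hxC, hxM⟩
  by_contra hCM
  obtain ⟨y, hyC, hyM⟩ := not_subset.1 hCM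
  refine hC.not_indep ?_
  have h1 : (M.disjointSum N h).Indep (C ∩ M.E) :=
    hC.ssubset_indep ⟨inter_subset_left, fun hs => hyM (hs hyC).2⟩
  have h2 : (M.disjointSum N h).Indep (C ∩ N.E) :=
    hC.ssubset_indep ⟨inter_subset_left, fun hs => h.le_bot ⟨hxM, (hs hxC).2⟩⟩
  rw [disjointSum_indep_iff] at h1 h2
  rw [disjointSum_indep_iff]
  exact ⟨by simpa [inter_assoc] using h1.1, by simpa [inter_assoc] using h2.2.1,
    by simpa using hC.subset_ground⟩

instance [M.Finite] [N.Finite] : (M.disjointSum N h).Finite :=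
  ⟨by simpa using ⟨M.ground_finite, N.ground_finite⟩⟩

lemma contractionDepth_disjointSum_le [M.Finite] [N.Finite] {d : ℕ}
    (hM : M.contractionDepth ≤ d) (hN : N.contractionDepth ≤ d) :
    (M.disjointSum N h).contractionDepth ≤ d := by
  have h1 : (M.disjointSum N h) ↾ M.E = M := isRestriction_disjointSum_left.eq_restrict
  have h2 : (M.disjointSum N h) ↾ ((M.disjointSum N h).E \ M.E) = N := by
    rw [disjointSum_ground_eq, union_sdiff_left, h.symm.sdiff_eq_left]
    exact isRestriction_disjointSum_right.eq_restrict
  have : ((M.disjointSum N h) ↾ M.E).Finite := by rwa [h1]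
  have : ((M.disjointSum N h) ↾ ((M.disjointSum N h).E \ M.E)).Finite := by rwa [h2]
  refine separates_disjointSum.contractionDepth_le (by simp) ?_ ?_
  · rwa [contractionDepth_congr h1]
  · rwa [contractionDepth_congr h2]

end disjointSum

end Matroid

/-! ### Tree-like families of sets and their splits. -/

section

variable {β γ : Type*}

/-- A family of finite sets is tree-like if the traces of its members on any of its members form a
chain. The paths from the root of a rooted tree are an example. -/
def TreeLike (P : β → Finset γ) (E : Set β) : Prop :=
  ∀ ⦃x⦄, x ∈ E → ∀ ⦃y⦄, y ∈ E → ∀ ⦃z⦄, z ∈ E →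
    (∀ v ∈ P x, v ∈ P y → v ∈ P z) ∨ (∀ v ∈ P z, v ∈ P y → v ∈ P x)

/-- The union of the sets `P x` with `x ∈ X`. -/
def cover (P : β → Finset γ) (X : Set β) : Set γ := {v | ∃ x ∈ X, v ∈ P x}

/-- The intersection of the sets `P x` with `x ∈ X`. -/
def core (P : β → Finset γ) (X : Set β) : Set γ := {v | ∀ x ∈ X, v ∈ P x}

variable {P : β → Finset γ} {E X Y : Set β}

lemma finite_cover (hX : X.Finite) : (cover P X).Finite := by
  refine (hX.biUnion fun x _ => (P x).finite_toSet).subset ?_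
  rintro v ⟨x, hx, hv⟩
  exact mem_biUnion hx hv

lemma cover_union : cover P (X ∪ Y) = cover P X ∪ cover P Y := by
  ext v
  simp only [cover, mem_ofPred_eq, mem_union]
  constructor
  · rintro ⟨x, hx | hx, hv⟩
    · exact Or.inl ⟨x, hx, hv⟩
    · exact Or.inr ⟨x, hx, hv⟩
  · rintro (⟨x, hx, hv⟩ | ⟨x, hx, hv⟩)
    · exact ⟨x, Or.inl hx, hv⟩
    · exact ⟨x, Or.inr hx, hv⟩

lemma core_subset_cover (hX : X.Nonempty) (hXE : X ⊆ E) : core P E ⊆ cover P X :=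
  fun _ hv => hX.imp fun x hx => ⟨hx, hv x (hXE hx)⟩

/-- The two sides of a partition of `E` share only the core of a family. -/
def IsSplit (P : β → Finset γ) (E A : Set β) : Prop :=
  ∀ x ∈ A, ∀ y ∈ E \ A, ∀ v ∈ P x, v ∈ P y → v ∈ core P E

lemma IsSplit.symm {A : Set β} (h : IsSplit P E A) (hA : A ⊆ E) : IsSplit P E (E \ A) := by
  rw [IsSplit, sdiff_sdiff_cancel_left hA]
  exact fun x hx y hy v hvx hvy => h y hy x hx v hvy hvx

/-- A tree-like family with at least two members branches somewhere. -/
lemma TreeLike.exists_isSplit [DecidableEq γ] (hT : TreeLike P E) (hE : E.Nontrivial)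
    (hfin : E.Finite) : ∃ A ⊆ E, A.Nonempty ∧ (E \ A).Nonempty ∧ IsSplit P E A := by
  obtain ⟨x₀, hx₀⟩ := hE.nonempty
  by_cases hcore : ∀ v ∈ P x₀, v ∈ core P E
  · obtain ⟨y, hy, hne⟩ := hE.exists_ne x₀
    refine ⟨{x₀}, by simpa using hx₀, singleton_nonempty _, ⟨y, hy, hne⟩, ?_⟩
    rintro x rfl y - v hv -
    exact hcore v hv
  push Not at hcore
  obtain ⟨v₀, hv₀, hv₀c⟩ := hcore
  -- One side collects the members that share a non-core element with `P x₀`: the branch of `x₀`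
  -- below the core.
  refine ⟨{y ∈ E | ∃ v ∈ P x₀, v ∈ P y ∧ v ∉ core P E}, fun y hy => hy.1,
    ⟨x₀, hx₀, v₀, hv₀, hv₀, hv₀c⟩, ?_, ?_⟩
  · obtain ⟨y, hy, hmin⟩ := hfin.exists_minimalFor (fun y => (P x₀ ∩ P y).card) E ⟨x₀, hx₀⟩
    refine ⟨y, hy, fun hyA => ?_⟩
    obtain ⟨-, v, hvx, hvy, hvc⟩ := hyA
    refine hvc fun z hz => ?_
    obtain h | h := hT hy hx₀ hz
    · exact h v hvy hvx
    · have hsub : P x₀ ∩ P z ⊆ P x₀ ∩ P y := fun u hu => by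
        rw [Finset.mem_inter] at hu ⊢
        exact ⟨hu.1, h u hu.2 hu.1⟩
      have heq := Finset.eq_of_subset_of_card_le hsub (hmin hz (Finset.card_le_card hsub))
      exact (Finset.mem_inter.1 (heq.symm ▸ Finset.mem_inter.2 ⟨hvx, hvy⟩ : v ∈ P x₀ ∩ P z)).2
  · rintro x ⟨hx, u, hux₀, hux, huc⟩ y ⟨hy, hyA⟩ v hvx hvy
    by_contra hvc
    obtain h | h := hT hx₀ hx hy
    · exact hyA ⟨hy, u, hux₀, h u hux₀ hux, huc⟩
    · exact hyA ⟨hy, v, h v hvy hvx, hvy, hvc⟩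

/-! ### Tree-like decompositions of a matroid. -/

namespace Matroid

variable {M N : Matroid β} {A C D I J S X Y : Set β} {e f : β}

/-- A tree-like family of sets that decomposes `M`: every set is covered by at least as many
elements as its rank, with equality for the ground set. -/
structure IsTreeDecomposition (M : Matroid β) (P : β → Finset γ) : Prop where
  treeLike : TreeLike P M.E
  rank_le : ∀ X ⊆ M.E, M.natRk X ≤ (cover P X).ncard
  card_le : (cover P M.E).ncard ≤ M.natRk M.E

/-- Inclusion-exclusion: the two covers overlap exactly in the core, which both contain because `X`
and `A` are non-empty. -/
lemma ncard_cover_union_of_isSplit [M.Finite] (hA : A ⊆ M.E) (hA0 : A.Nonempty)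
    (hs : IsSplit P M.E A) (hX : X ⊆ M.E \ A) (hX0 : X.Nonempty) :
    (cover P (X ∪ A)).ncard + (core P M.E).ncard = (cover P X).ncard + (cover P A).ncard := by
  have hXE : X ⊆ M.E := hX.trans sdiff_subset
  have hinter : cover P X ∩ cover P A = core P M.E := by
    refine Subset.antisymm ?_ (subset_inter (core_subset_cover hX0 hXE) (core_subset_cover hA0 hA))
    rintro v ⟨⟨y, hy, hvy⟩, ⟨x, hx, hvx⟩⟩
    exact hs x hx y (hX hy) v hvx hvy
  rw [cover_union, ← hinter, ncard_union_add_ncard_inter _ _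
    (finite_cover (M.ground_finite.subset hXE)) (finite_cover (M.ground_finite.subset hA))]

/-- If one side of a split does not attain its maximum possible rank, then the
branching point can be moved towards the root. -/
lemma IsTreeDecomposition.exists_erase [DecidableEq γ] [M.Finite] (hP : M.IsTreeDecomposition P)
    (hA : A ⊆ M.E) (hA0 : A.Nonempty) (hA1 : (M.E \ A).Nonempty) (hs : IsSplit P M.E A)
    (hlt : M.natRk (M.E \ A) < (cover P (M.E \ A)).ncard) :
    ∃ Q : β → Finset γ, M.IsTreeDecomposition Q ∧ (∀ x, Q x ⊆ P x) ∧
      ∃ x ∈ M.E, (Q x).card < (P x).card := by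
  classical
  have hfull := ncard_cover_union_of_isSplit hA hA0 hs Subset.rfl hA1
  have hE : M.E \ A ∪ A = M.E := sdiff_union_of_subset hA
  rw [hE] at hfull
  have hr := M.natRk_union_le (M.E \ A) A
  rw [hE] at hr
  have hrA := hP.rank_le A hA
  have hcard := hP.card_le
  -- With an empty core the two covers would be disjoint, and the slack on one side would make `M.E`
  -- cover more than its rank.
  obtain ⟨v, hv⟩ : (core P M.E).Nonempty := nonempty_of_ncard_ne_zero (by omega)
  set Q : β → Finset γ := fun x => if x ∈ A then P x else (P x).erase v with hQ
  have hQA : ∀ x, x ∈ A → Q x = P x := fun x hx => if_pos hx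
  have hQA' : ∀ x, x ∉ A → Q x = (P x).erase v := fun x hx => if_neg hx
  have hQP : ∀ x, Q x ⊆ P x := by
    intro x
    by_cases hx : x ∈ A
    · rw [hQA x hx]
    · rw [hQA' x hx]
      exact Finset.erase_subset _ _
  have herase : ∀ x, ∀ u ∈ P x, u ≠ v → u ∈ Q x := by
    intro x u hu huv
    by_cases hx : x ∈ A
    · rwa [hQA x hx]
    · rw [hQA' x hx]
      exact Finset.mem_erase.2 ⟨huv, hu⟩
  have hmeet : ∀ X ⊆ M.E, (X ∩ A).Nonempty → cover Q X = cover P X := by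
    rintro X hX ⟨a, haX, haA⟩
    ext u
    constructor
    · rintro ⟨x, hx, hu⟩
      exact ⟨x, hx, hQP x hu⟩
    · rintro ⟨x, hx, hu⟩
      by_cases huv : u = v
      · subst huv
        exact ⟨a, haX, by rw [hQA a haA]; exact hv a (hA haA)⟩
      · exact ⟨x, hx, herase x u hu huv⟩
  refine ⟨Q, ⟨?_, ?_, ?_⟩, hQP, ?_⟩
  · intro x hx y hy z hz
    -- If `y ∈ A`, a member of `Q` outside `A` meets `Q y` only in core elements other than `v`,
    -- which lie in every member. If `y ∉ A`, then `v ∉ Q y`, so erasing `v` elsewhere does not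
    -- change traces on `Q y`.
    by_cases hyA : y ∈ A
    · by_cases hxA : x ∈ A
      · by_cases hzA : z ∈ A
        · rw [hQA x hxA, hQA y hyA, hQA z hzA]
          exact hP.treeLike hx hy hz
        · right
          rw [hQA x hxA, hQA y hyA]
          intro u huz huy
          exact hs y hyA z ⟨hz, hzA⟩ u huy (hQP z huz) x hx
      · left
        intro u hux huy
        have huc := hs y hyA x ⟨hx, hxA⟩ u (hQP y huy) (hQP x hux)
        rw [hQA' x hxA, Finset.mem_erase] at hux
        exact herase z u (huc z hz) hux.1
    · have hne : ∀ u ∈ Q y, u ≠ v := by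
        intro u hu
        rw [hQA' y hyA, Finset.mem_erase] at hu
        exact hu.1
      obtain h | h := hP.treeLike hx hy hz
      · exact Or.inl fun u hux huy =>
          herase z u (h u (hQP x hux) (hQP y huy)) (hne u huy)
      · exact Or.inr fun u huz huy =>
          herase x u (h u (hQP z huz) (hQP y huy)) (hne u huy)
  · intro X hX
    obtain rfl | hX0 := X.eq_empty_or_nonempty
    · simp [natRk_empty]
    by_cases hXA : (X ∩ A).Nonempty
    · rw [hmeet X hX hXA]
      exact hP.rank_le X hX
    have hXd : X ⊆ M.E \ A := fun x hx => ⟨hX hx, fun hxA => hXA ⟨x, hx, hxA⟩⟩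
    have hcov : cover Q X = cover P X \ {v} := by
      ext u
      constructor
      · rintro ⟨x, hx, hu⟩
        have hu' := hu
        rw [hQA' x (hXd hx).2, Finset.mem_erase] at hu'
        exact ⟨⟨x, hx, hu'.2⟩, hu'.1⟩
      · rintro ⟨⟨x, hx, hu⟩, huv⟩
        exact ⟨x, hx, herase x u hu huv⟩
    have hvX : v ∈ cover P X := core_subset_cover hX0 hX hv
    rw [hcov, ncard_sdiff_singleton_of_mem hvX]
    -- Submodularity for `X ∪ A` and `M.E \ A` transfers the slack of `M.E \ A` to every subset `X`,
    -- whose cover may therefore lose `v`.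
    have h1 := ncard_cover_union_of_isSplit hA hA0 hs hXd hX0
    have h2 := hP.rank_le (X ∪ A) (union_subset hX hA)
    have h3 := M.natRk_inter_add_natRk_union_le (X ∪ A) (M.E \ A)
    have h4 : (X ∪ A) ∩ (M.E \ A) = X := by
      ext x
      have := @hXd x
      simp only [mem_inter_iff, mem_union, mem_sdiff] at this ⊢
      tauto
    have h5 : (X ∪ A) ∪ (M.E \ A) = M.E := by
      ext x
      have := @hX x
      have := @hA x
      simp only [mem_union, mem_sdiff]
      tauto
    rw [h4, h5] at h3
    omega
  · rw [hmeet M.E Subset.rfl (by rwa [inter_eq_self_of_subset_right hA])]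
    exact hcard
  · obtain ⟨x, hx⟩ := hA1
    refine ⟨x, hx.1, ?_⟩
    rw [hQA' x hx.2]
    exact Finset.card_erase_lt_of_mem (hv x hx.1)

/-- If one side of a split attains its maximum possible rank, then contracting it leaves a matroid
that is decomposed by what remains after the removal of the core. -/
lemma IsTreeDecomposition.contract [DecidableEq γ] [M.Finite] (hP : M.IsTreeDecomposition P)
    (hA : A ⊆ M.E) (hA0 : A.Nonempty) (hA1 : (M.E \ A).Nonempty) (hs : IsSplit P M.E A)
    {K : Finset γ} (hK : (K : Set γ) = core P M.E)
    (htight : M.natRk (M.E \ A) = (cover P (M.E \ A)).ncard) :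
    (M ／ (M.E \ A)).IsTreeDecomposition (fun x => P x \ K) := by
  have hground : (M ／ (M.E \ A)).E = A := by
    rw [contract_ground, sdiff_sdiff_cancel_left hA]
  have hcov : ∀ X, cover (fun x => P x \ K) X = cover P X \ K := by
    intro X
    ext v
    simp only [cover, Finset.mem_sdiff, mem_ofPred_eq, mem_sdiff, Finset.mem_coe]
    tauto
  have hE : M.E \ A ∪ A = M.E := sdiff_union_of_subset hA
  constructor
  · intro x hx y hy z hz
    rw [hground] at hx hy hz
    simp only [Finset.mem_sdiff]
    obtain h | h := hP.treeLike (hA hx) (hA hy) (hA hz)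
    · exact Or.inl fun v h1 h2 => ⟨h v h1.1 h2.1, h1.2⟩
    · exact Or.inr fun v h1 h2 => ⟨h v h1.1 h2.1, h1.2⟩
  · intro X hX
    rw [hground] at hX
    have h1 := M.natRk_contract_add_natRk (M.E \ A) X
    have h2 := hP.rank_le (X ∪ (M.E \ A)) (union_subset (hX.trans hA) sdiff_subset)
    have hfin := finite_cover (P := P) (M.ground_finite.subset (hX.trans hA))
    -- The core is already counted in the cover of `M.E \ A`, whose size is by tightness the rank
    -- lost in the contraction.
    have h3 : cover P (X ∪ (M.E \ A)) ⊆ (cover P X \ K) ∪ cover P (M.E \ A) := by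
      rw [cover_union]
      refine union_subset (fun v hv => ?_) subset_union_right
      by_cases hvK : v ∈ (K : Set γ)
      · exact Or.inr (core_subset_cover hA1 sdiff_subset (hK ▸ hvK))
      · exact Or.inl ⟨hv, hvK⟩
    have h4 := (ncard_le_ncard h3 ((hfin.subset sdiff_subset).union
      (finite_cover (M.ground_finite.subset sdiff_subset)))).trans (ncard_union_le _ _)
    rw [hcov]
    omega
  · rw [hground, hcov]
    have h1 := M.natRk_contract_add_natRk (M.E \ A) A
    rw [union_comm, hE] at h1
    have h2 := ncard_cover_union_of_isSplit hA hA0 hs Subset.rfl hA1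
    rw [hE] at h2
    have h3 : (cover P A \ K).ncard + (K : Set γ).ncard = (cover P A).ncard :=
      ncard_sdiff_add_ncard_of_subset (hK ▸ core_subset_cover hA0 hA)
        (finite_cover (M.ground_finite.subset hA))
    have h4 := hP.card_le
    rw [hK] at h3 ⊢
    omega

end Matroid

end

/-! ### Construction of the extension. -/

namespace Matroid

variable {β γ : Type*} {M N : Matroid β} {P : β → Finset γ} {A C D F I J S X Y : Set β} {e f : β}

/-- Extensions of the two contractions `M ／ (M.E \ A)` and `M ／ A` combine to an extension of `M`,
whose contraction-depth grows by the connectivity of `A`. -/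
lemma exists_extension_of_contract [Infinite β] [M.Finite] (hA : A ⊆ M.E) {d k : ℕ}
    (hk : M.natRk A + M.natRk (M.E \ A) = M.natRk M.E + k) (hF : F.Finite)
    (h : ∀ B, B = A ∨ B = M.E \ A → ∀ F : Set β, F.Finite → ∃ N : Matroid β, ∃ _ : N.Finite,
      M ／ (M.E \ B) ≤r N ∧ Disjoint (N.E \ B) F ∧ N.contractionDepth ≤ d) :
    ∃ N : Matroid β, ∃ _ : N.Finite, M ≤r N ∧ Disjoint (N.E \ M.E) F ∧
      N.contractionDepth ≤ d + k := by
  obtain ⟨N₁, hN₁fin, hr₁, hd₁, hc₁⟩ := h A (Or.inl rfl) (F ∪ M.E) (hF.union M.ground_finite)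
  -- The set to be avoided makes the new elements of the second extension disjoint from the first.
  obtain ⟨N₂, hN₂fin, hr₂, hd₂, hc₂⟩ := h (M.E \ A) (Or.inr rfl) (F ∪ M.E ∪ N₁.E)
    ((hF.union M.ground_finite).union N₁.ground_finite)
  rw [sdiff_sdiff_cancel_left hA] at hr₂
  have hE₁ : (M ／ (M.E \ A)).E = A := by
    rw [contract_ground, sdiff_sdiff_cancel_left hA]
  have hE₂ : (M ／ A).E = M.E \ A := rfl
  have hs₁ : A ⊆ N₁.E := hE₁ ▸ hr₁.subset
  have hs₂ : M.E \ A ⊆ N₂.E := hr₂.subset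
  rw [Set.disjoint_left] at hd₁ hd₂
  have hN₁A : ∀ x ∈ M.E, x ∈ N₁.E → x ∈ A := fun x hx hx₁ => by
    by_contra hxA
    exact hd₁ ⟨hx₁, hxA⟩ (Or.inr hx)
  have hN₂A : ∀ x ∈ M.E, x ∈ N₂.E → x ∉ A := fun x hx hx₂ hxA =>
    hd₂ ⟨hx₂, fun h => h.2 hxA⟩ (Or.inl (Or.inr hx))
  have hdisj : Disjoint N₁.E N₂.E := by
    rw [Set.disjoint_left]
    intro x h1 h2
    by_cases hxE : x ∈ M.E
    · exact hN₂A x hxE h2 (hN₁A x hxE h1)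
    · exact hd₂ ⟨h2, fun h => hxE h.1⟩ (Or.inr h1)
  set N := N₁.disjointSum N₂ hdisj with hN
  have hNE : N.E = N₁.E ∪ N₂.E := disjointSum_ground_eq
  have hres₁ : N₁ ≤r N := isRestriction_disjointSum_left
  have hres₂ : N₂ ≤r N := isRestriction_disjointSum_right
  have hME : M.E ⊆ N.E := by
    rw [hNE]
    intro x hx
    by_cases hxA : x ∈ A
    · exact Or.inl (hs₁ hxA)
    · exact Or.inr (hs₂ ⟨hx, hxA⟩)
  have hfin : (F ∪ N.E).Finite := hF.union N.ground_finite
  obtain ⟨T, hTsub, hTcard⟩ := hfin.infinite_compl.exists_subset_card_eq k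
  set S : Set β := ↑T with hS
  have hSfin : S.Finite := T.finite_toSet
  have hScard : S.ncard = k := by rw [hS, ncard_coe_finset, hTcard]
  have hNS : Disjoint N.E S := by
    rw [Set.disjoint_right]
    exact fun x hx hxN => hTsub hx (Or.inr hxN)
  -- An element of `A` spanned by `X` in `M` is spanned by `X` in `M ／ (M.E \ A)`, hence in `N`; the
  -- other side is symmetric.
  have hcl : ∀ X, M.closure X ⊆ N.closure X := by
    intro X x hx
    have hxE : x ∈ M.E := M.closure_subset_ground X hx
    by_cases hxA : x ∈ A
    · refine hres₁.closure_subset X (hr₁.closure_subset X ?_)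
      rw [contract_closure_eq]
      exact ⟨M.closure_mono subset_union_left hx, fun h => h.2 hxA⟩
    · refine hres₂.closure_subset X (hr₂.closure_subset X ?_)
      rw [contract_closure_eq]
      exact ⟨M.closure_mono subset_union_left hx, hxA⟩
  have hrank : ∀ I, M.Indep I → I.ncard ≤ N.natRk I + S.ncard := by
    intro I hI
    have hIE := hI.subset_ground
    have hIfin := M.ground_finite.subset hIE
    rw [← (indep_iff_natRk_eq hIfin).1 hI, hScard]
    have h1 : N.natRk (I ∩ N₁.E) + N.natRk (I \ N₁.E) ≤ N.natRk I := by
      rw [← Nat.cast_le (α := ℕ∞)]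
      push_cast [coe_natRk]
      exact separates_disjointSum.eRk_add_le I
    have h2 : I ∩ N₁.E = I ∩ A := by
      ext x
      exact ⟨fun hx => ⟨hx.1, hN₁A x (hIE hx.1) hx.2⟩, fun hx => ⟨hx.1, hs₁ hx.2⟩⟩
    have h3 : I \ N₁.E = I \ A := by
      ext x
      exact ⟨fun hx => ⟨hx.1, fun hxA => hx.2 (hs₁ hxA)⟩,
        fun hx => ⟨hx.1, fun hx₁ => hx.2 (hN₁A x (hIE hx.1) hx₁)⟩⟩
    have h4 : I \ A ⊆ M.E \ A := sdiff_subset_sdiff_left hIE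
    rw [h2, h3, hres₁.natRk_eq (inter_subset_right.trans hs₁), hres₂.natRk_eq (h4.trans hs₂),
      hr₁.natRk_eq (hE₁.symm ▸ inter_subset_right), hr₂.natRk_eq h4] at h1
    have h5 := M.natRk_contract_add_natRk (M.E \ A) (I ∩ A)
    -- Passing from `M` to `N` lowers the rank of `I` by at most `k`, by submodularity for `I ∪ (M.E
    -- \ A)` and `I ∪ A`.
    have h6 := M.natRk_contract_add_natRk A (I \ A)
    have h7 := M.natRk_inter_add_natRk_union_le (I ∩ A ∪ M.E \ A) (I \ A ∪ A)
    have h8 : (I ∩ A ∪ M.E \ A) ∩ (I \ A ∪ A) = I := by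
      ext x
      have := @hIE x
      simp only [mem_inter_iff, mem_union, mem_sdiff]
      tauto
    have h9 : (I ∩ A ∪ M.E \ A) ∪ (I \ A ∪ A) = M.E := by
      ext x
      have := @hIE x
      have := @hA x
      simp only [mem_inter_iff, mem_union, mem_sdiff]
      tauto
    rw [h8, h9] at h7
    omega
  refine ⟨quotientLift M N S hSfin hcl, inferInstance, isRestriction_quotientLift hME hrank, ?_, ?_⟩
  · rw [quotientLift_ground, hNE, Set.disjoint_left]
    rintro x ⟨(hx | hx) | hx, hxE⟩ hxF
    · exact hd₁ ⟨hx, fun h => hxE (hA h)⟩ (Or.inl hxF)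
    · exact hd₂ ⟨hx, fun h => hxE h.1⟩ (Or.inl (Or.inl hxF))
    · exact hTsub hx (Or.inl hxF)
  · have h1 := (quotientLift M N S hSfin hcl).contractionDepth_le_contract_add_ncard hSfin
    rw [contractionDepth_congr (quotientLift_contract hME hNS), hScard] at h1
    have h2 : N.contractionDepth ≤ d := contractionDepth_disjointSum_le hc₁ hc₂
    omega

/-- A matroid with a tree-like decomposition by sets of size at most `d` extends to a matroid of
contraction-depth at most `d + 1`. -/
theorem IsTreeDecomposition.exists_extension [Infinite β] [DecidableEq γ] [hM : M.Finite]
    (hP : M.IsTreeDecomposition P) {d : ℕ} (hd : ∀ x ∈ M.E, (P x).card ≤ d) (hF : F.Finite) :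
    ∃ N : Matroid β, ∃ _ : N.Finite, M ≤r N ∧ Disjoint (N.E \ M.E) F ∧
      N.contractionDepth ≤ d + 1 := by
  -- Erasing lowers the sum of the sizes; contracting lowers the number of elements.
  induction hn : M.E.ncard + ∑ x ∈ M.ground_finite.toFinset, (P x).card using
    Nat.strong_induction_on generalizing M P F d with
  | _ n ih =>
    by_cases hcard : M.E.ncard ≤ 1
    · refine ⟨M, hM, IsRestriction.refl, by simp, ?_⟩
      exact (contractionDepth_of_subsingleton
        (fun a ha b hb => (ncard_le_one M.ground_finite).1 hcard a ha b hb)).trans (by omega)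
    push Not at hcard
    obtain ⟨A, hA, hA0, hA1, hs⟩ := hP.treeLike.exists_isSplit
      (by have := M.ground_finite.to_subtype; exact one_lt_ncard_iff_nontrivial.1 hcard) M.ground_finite
    have herase : ∀ B ⊆ M.E, B.Nonempty → (M.E \ B).Nonempty → IsSplit P M.E B →
        M.natRk (M.E \ B) < (cover P (M.E \ B)).ncard →
        ∃ N : Matroid β, ∃ _ : N.Finite, M ≤r N ∧ Disjoint (N.E \ M.E) F ∧
          N.contractionDepth ≤ d + 1 := by
      intro B hB hB0 hB1 hsB hlt
      obtain ⟨Q, hQ, hQP, x, hx, hxlt⟩ := hP.exists_erase hB hB0 hB1 hsB hlt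
      refine ih _ ?_ hQ (fun x hx => (Finset.card_le_card (hQP x)).trans (hd x hx)) hF rfl
      rw [← hn]
      refine Nat.add_lt_add_left (Finset.sum_lt_sum (fun x _ => Finset.card_le_card (hQP x)) ?_) _
      exact ⟨x, by simpa using hx, hxlt⟩
    have hcancel : M.E \ (M.E \ A) = A := sdiff_sdiff_cancel_left hA
    have hs' := hs.symm hA
    by_cases hlt₂ : M.natRk (M.E \ A) < (cover P (M.E \ A)).ncard
    · exact herase A hA hA0 hA1 hs hlt₂
    by_cases hlt₁ : M.natRk A < (cover P A).ncard
    · exact herase (M.E \ A) sdiff_subset hA1 (by rwa [hcancel]) hs' (by rwa [hcancel])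
    have ht₂ := (hP.rank_le _ (sdiff_subset (s := M.E) (t := A))).antisymm (not_lt.1 hlt₂)
    have ht₁ := (hP.rank_le _ hA).antisymm (not_lt.1 hlt₁)
    obtain ⟨x₀, hx₀⟩ := hA0
    have hcore : core P M.E ⊆ P x₀ := fun v hv => hv x₀ (hA hx₀)
    obtain ⟨K, hK⟩ := ((P x₀).finite_toSet.subset hcore).exists_finset_coe
    have hKsub : ∀ x ∈ M.E, K ⊆ P x := by
      intro x hx v hv
      exact (hK ▸ (Finset.mem_coe.2 hv) : v ∈ core P M.E) x hx
    have hKd : K.card ≤ d := (Finset.card_le_card (hKsub x₀ (hA hx₀))).trans (hd x₀ (hA hx₀))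
    have hfull := ncard_cover_union_of_isSplit hA ⟨x₀, hx₀⟩ hs Subset.rfl hA1
    rw [sdiff_union_of_subset hA, ← hK, ncard_coe_finset] at hfull
    have hrk := (hP.rank_le _ Subset.rfl).antisymm hP.card_le
    have haux : ∀ B ⊆ M.E, B.Nonempty → (M.E \ B).Nonempty → IsSplit P M.E B →
        M.natRk (M.E \ B) = (cover P (M.E \ B)).ncard → ∀ F : Set β, F.Finite →
        ∃ N : Matroid β, ∃ _ : N.Finite, M ／ (M.E \ B) ≤r N ∧ Disjoint (N.E \ B) F ∧
          N.contractionDepth ≤ d - K.card + 1 := by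
      intro B hB hB0 hB1 hsB htB F hF
      have hground : (M ／ (M.E \ B)).E = B := by
        rw [contract_ground, sdiff_sdiff_cancel_left hB]
      have hQ := hP.contract hB hB0 hB1 hsB hK htB
      have := ih _ ?_ hQ (d := d - K.card) (fun x hx => ?_) hF rfl
      · rwa [hground] at this
      · rw [← hn]
        refine Nat.add_lt_add_of_lt_of_le ?_ ?_
        · rw [hground]
          refine ncard_lt_ncard (hB.ssubset_of_ne ?_) M.ground_finite
          rintro rfl
          simp at hB1
        · refine (Finset.sum_le_sum fun x _ => Finset.card_le_card Finset.sdiff_subset).trans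
            (Finset.sum_le_sum_of_subset ?_)
          intro x hx
          simp only [Finite.mem_toFinset, hground] at hx ⊢
          exact hB hx
      · rw [hground] at hx
        rw [Finset.card_sdiff_of_subset (hKsub x (hB hx))]
        exact Nat.sub_le_sub_right (hd x (hB hx)) _
    -- Both sides and `M.E` are tight, so the connectivity of `A` is the size of the core.
    obtain ⟨N, hN, h1, h2, h3⟩ := exists_extension_of_contract (k := K.card)
      (d := d - K.card + 1) hA (by omega) hF (by
      rintro B (rfl | rfl)
      · exact haux B hA ⟨x₀, hx₀⟩ hA1 hs ht₂
      · exact haux (M.E \ A) sdiff_subset hA1 (by rw [hcancel]; exact ⟨x₀, hx₀⟩) hs'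
          (by rwa [hcancel]))
    exact ⟨N, hN, h1, h2, by omega⟩

end Matroid

/-! ### The two inequalities and the exceptional case. -/

namespace Matroid

variable {α β : Type*} {M : Matroid α} {N : Matroid β}

lemma IsContractionStarDecomposition.contractionStarDepth_le {T : RootedTree.{0}} {f : α → T}
    (h : M.IsContractionStarDecomposition T f) : M.contractionStarDepth ≤ T.depth :=
  Nat.sInf_le ⟨T, f, h, rfl⟩

lemma IsPathDecomposition.contractionStarDepth_le [M.Finite] {p : α → List ℕ}
    (h : M.IsPathDecomposition p) {d : ℕ} (hd : ∀ x ∈ M.E, (p x).length ≤ d) :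
    M.contractionStarDepth ≤ d := by
  obtain ⟨T, f, hT, hTd⟩ := h.exists_isContractionStarDecomposition hd
  exact hT.contractionStarDepth_le.trans hTd

/-- The contraction-star-depth is attained. -/
lemma exists_isContractionStarDecomposition_depth_eq (M : Matroid α) [M.Finite] :
    ∃ (T : RootedTree.{0}) (f : α → T),
      M.IsContractionStarDecomposition T f ∧ T.depth = M.contractionStarDepth := by
  obtain ⟨p, hp, -⟩ := M.exists_isPathDecomposition_restrict (X := M.E) Subset.rfl
  rw [restrict_ground_eq_self] at hp
  obtain ⟨d, hd⟩ := (M.ground_finite.image fun x => (p x).length).bddAbove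
  obtain ⟨T, f, hT, -⟩ := hp.exists_isContractionStarDecomposition
    (fun x hx => hd (mem_image_of_mem _ hx))
  exact Nat.sInf_mem (s := {d : ℕ | ∃ (T : RootedTree.{0}) (f : α → T),
    M.IsContractionStarDecomposition T f ∧ T.depth = d}) ⟨_, T, f, hT, rfl⟩

lemma prefixSet_comp (p : β → List ℕ) (f : α → β) (X : Set α) :
    prefixSet (p ∘ f) X = prefixSet p (f '' X) := by
  ext l
  simp [prefixSet]

lemma IsPathDecomposition.of_map {f : α → β} {hf : InjOn f M.E} {p : β → List ℕ}
    (h : (M.map f hf).IsPathDecomposition p) : M.IsPathDecomposition (p ∘ f) where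
  rank_le X hX := by
    rw [prefixSet_comp, ← M.eRk_map hf hX]
    exact h.rank_le _ (image_mono hX)
  card_le := by
    rw [prefixSet_comp, ← M.eRk_map hf Subset.rfl]
    exact h.card_le

lemma map_isColoop_iff {f : α → β} {hf : InjOn f M.E} {e : α} (he : e ∈ M.E) :
    (M.map f hf).IsColoop (f e) ↔ M.IsColoop e := by
  have hf' : InjOn f M✶.E := hf
  rw [← dual_isLoop_iff_isColoop, map_dual, ← dual_isLoop_iff_isColoop]
  exact map_isLoop_iff (M := M✶) (hf := hf') he

/-- If all elements are loops, the coloop alternative never occurs. Otherwise some element is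
neither a loop nor a coloop; its word is non-empty, so `N` has depth at least two and words of
length one are short enough. -/
lemma contractionStarDepth_lt_of_isExtendedBy [M.Finite] [N.Finite] (hM : ¬ M.IsExceptional)
    (h : M.IsExtendedBy N) : M.contractionStarDepth + 1 ≤ N.contractionDepth := by
  obtain ⟨f, hf, hr⟩ := h
  have hX : f '' M.E ⊆ N.E := hr.subset
  obtain ⟨p, hp, hlen⟩ := N.exists_isPathDecomposition_restrict hX
  rw [show N ↾ (f '' M.E) = M.map f hf from hr.eq_restrict] at hp hlen
  have key : ∀ e ∈ M.E, ¬ M.IsColoop e → (p (f e)).length + 1 ≤ N.contractionDepth :=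
    fun e he hco => (hlen (f e) (mem_image_of_mem f he)).resolve_right
      fun h => hco ((map_isColoop_iff he).1 h.1)
  have hall : ∀ e ∈ M.E, (p (f e)).length + 1 ≤ N.contractionDepth := by
    by_cases hex : ∀ e ∈ M.E, M.IsLoop e ∨ M.IsColoop e
    · have hl : M.E.Nonempty ∧ ∀ e ∈ M.E, M.IsLoop e := by
        by_contra hcon
        exact hM ⟨hex, hcon⟩
      exact fun e he => key e he (hl.2 e he).not_isColoop
    · push Not at hex
      obtain ⟨e, he, hloop, hcoloop⟩ := hex
      have h1 := key e he hcoloop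
      have h2 : p (f e) ≠ [] := by
        intro hnil
        have := hp.of_map.rank_le {e} (by simpa using he)
        rw [prefixSet_of_forall_eq_nil (by simpa using hnil),
          ((not_isLoop_iff he).1 hloop).eRk_eq] at this
        simp at this
      have h3 := List.length_pos_iff.2 h2
      intro x hx
      obtain h | h := hlen (f x) (mem_image_of_mem f hx)
      · exact h
      · omega
  have hne : M.E.Nonempty := by
    by_contra hcon
    rw [not_nonempty_iff_eq_empty] at hcon
    exact hM ⟨by simp [hcon], fun h => by simp [hcon] at h⟩
  have hpos := one_le_contractionDepth ((hne.image f).mono hX)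
  have := hp.of_map.contractionStarDepth_le (d := N.contractionDepth - 1) (fun x hx => by
    have := hall x hx
    simp only [Function.comp_apply]
    omega)
  omega

/-- The extension theorem: some extension has contraction-depth at most one more
than the contraction-star-depth. -/
lemma exists_isExtendedBy_contractionDepth_le (M : Matroid α) [M.Finite] :
    ∃ (β : Type v) (N : Matroid β) (_ : N.Finite),
      M.IsExtendedBy N ∧ N.contractionDepth ≤ M.contractionStarDepth + 1 := by
  classical
  obtain ⟨T, f, hT, hdepth⟩ := M.exists_isContractionStarDecomposition_depth_eq
  have hTfin := hT.finite_tree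
  -- The matroid is copied into an infinite type, which leaves room for the added elements in the
  -- required universe.
  obtain ⟨j, hj⟩ := countable_iff_exists_injOn.1 M.ground_finite.countable
  set i : α → ULift.{v} ℕ := fun x => ⟨j x⟩ with hi
  have hinj : InjOn i M.E := fun x hx y hy hxy => hj hx hy (ULift.up.inj hxy)
  set path : α → Finset T := fun x => (toFinite {v : T | v ≠ ⊥ ∧ v ≤ f x}).toFinset with hpath
  have hmem : ∀ x v, v ∈ path x ↔ v ≠ ⊥ ∧ v ≤ f x := by simp [hpath]
  obtain ⟨P, hP⟩ : ∃ P : ULift.{v} ℕ → Finset T, ∀ x ∈ M.E, P (i x) = path x := by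
    refine ⟨fun y => if h : ∃ x ∈ M.E, i x = y then path h.choose else ∅, fun x hx => ?_⟩
    have h : ∃ x' ∈ M.E, i x' = i x := ⟨x, hx, rfl⟩
    change (if h : ∃ x' ∈ M.E, i x' = i x then path h.choose else ∅) = path x
    rw [dif_pos h, hinj h.choose_spec.1 hx h.choose_spec.2]
  have hcover : ∀ X ⊆ M.E, cover P (i '' X) = T.closureEdges (f '' X) := by
    intro X hX
    ext v
    constructor
    · rintro ⟨_, ⟨x, hx, rfl⟩, hv⟩
      rw [hP x (hX hx), hmem] at hv
      exact ⟨hv.1, f x, mem_image_of_mem f hx, hv.2⟩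
    · rintro ⟨hv0, _, ⟨x, hx, rfl⟩, hv⟩
      exact ⟨i x, mem_image_of_mem i hx, by rw [hP x (hX hx), hmem]; exact ⟨hv0, hv⟩⟩
  have : (M.map i hinj).Finite := ⟨M.ground_finite.image i⟩
  have hdec : (M.map i hinj).IsTreeDecomposition P := by
    refine ⟨?_, fun X hX => ?_, ?_⟩
    · rintro _ ⟨x, hx, rfl⟩ _ ⟨y, hy, rfl⟩ _ ⟨z, hz, rfl⟩
      simp only [hP x hx, hP y hy, hP z hz, hmem]
      -- The vertices below `f y` form a chain, so the branching points of the paths to `f x` and `f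
      -- z` from it are comparable.
      obtain h | h := le_total_of_directed (inf_le_right : f x ⊓ f y ≤ f y)
        (inf_le_right : f z ⊓ f y ≤ f y)
      · exact Or.inr fun v hv hv' => ⟨hv.1, (le_inf hv.2 hv'.2).trans (h.trans inf_le_left)⟩
      · exact Or.inl fun v hv hv' => ⟨hv.1, (le_inf hv.2 hv'.2).trans (h.trans inf_le_left)⟩
    · obtain ⟨Y, hY, rfl⟩ := subset_image_iff.1 hX
      rw [← Nat.cast_le (α := ℕ∞), coe_natRk, M.eRk_map hinj hY, hcover Y hY,
        (toFinite _).cast_ncard_eq]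
      exact hT.rank_le Y hY
    · rw [map_ground, ← Nat.cast_le (α := ℕ∞), coe_natRk, M.eRk_map hinj Subset.rfl,
        hcover _ Subset.rfl, (toFinite _).cast_ncard_eq, eRk_ground, ← hT.card_edges]
      exact encard_le_encard fun v hv => hv.1
  have hcard : ∀ y ∈ (M.map i hinj).E, (P y).card ≤ M.contractionStarDepth := by
    rintro _ ⟨x, hx, rfl⟩
    rw [hP x hx, ← hdepth, ← ncard_coe_finset]
    have : (path x : Set T) = T.closureEdges {f x} := by
      ext v
      simp [hmem, RootedTree.closureEdges]
    rw [this]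
    exact le_ciSup (f := fun v : T => (T.closureEdges {v}).ncard) (finite_range _).bddAbove (f x)
  obtain ⟨N, hN, hr, -, hd⟩ := hdec.exists_extension hcard finite_empty
  exact ⟨ULift.{v} ℕ, N, hN, ⟨i, hinj, hr⟩, hd⟩

/-- When `M` is non-empty, both depths are at most one; a nonloop forces an edge on its path, so the
star-depth is not zero. -/
lemma IsExceptional.contractionStarDepth_eq [M.Finite] (hM : M.IsExceptional) :
    M.contractionStarDepth = M.contractionDepth ∧
      (M.contractionDepth = 0 ∨ M.contractionDepth = 1) := by
  obtain ⟨p, hp, hlen⟩ := M.exists_isPathDecomposition_restrict (X := M.E) Subset.rfl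
  rw [restrict_ground_eq_self] at hp hlen
  obtain hE | hE := M.E.eq_empty_or_nonempty
  · have h0 := contractionDepth_of_ground_eq_empty hE
    have := hp.contractionStarDepth_le (d := 0) (by simp [hE])
    omega
  have hle := contractionDepth_le_one_of_forall hM.1
  have hpos := one_le_contractionDepth hE
  have hstar := hp.contractionStarDepth_le (d := 1) (fun x hx => by
    obtain h | h := hlen x hx
    · omega
    · exact h.2)
  obtain ⟨e, he, hloop⟩ : ∃ e ∈ M.E, ¬ M.IsLoop e := by
    by_contra! hcon
    exact hM.2 ⟨hE, hcon⟩
  have hne : M.contractionStarDepth ≠ 0 := by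
    intro h0
    obtain ⟨T, f, hT, hdepth⟩ := M.exists_isContractionStarDecomposition_depth_eq
    have hTfin := hT.finite_tree
    have h1 := hT.rank_le {e} (by simpa using he)
    rw [image_singleton, ((not_isLoop_iff he).1 hloop).eRk_eq, ← (toFinite _).cast_ncard_eq] at h1
    have h2 := le_ciSup (f := fun v : T => (T.closureEdges {v}).ncard) (finite_range _).bddAbove (f e)
    change _ ≤ T.depth at h2
    rw [hdepth, h0] at h2
    have h3 : 1 ≤ (T.closureEdges {f e}).ncard := by exact_mod_cast h1
    exact absurd (h3.trans h2) (by norm_num)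
  omega

end Matroid

theorem theorem1 {α : Type u} (M : Matroid α) [M.Finite] :
    (¬ M.IsExceptional →
      IsLeast
        {d : ℕ | ∃ (β : Type v) (N : Matroid β) (_ : N.Finite),
          M.IsExtendedBy N ∧ N.contractionDepth = d}
        (M.contractionStarDepth + 1)) ∧
    (M.IsExceptional →
      M.contractionStarDepth = M.contractionDepth ∧
        (M.contractionDepth = 0 ∨ M.contractionDepth = 1)) := by
  refine ⟨fun hM => ⟨?_, ?_⟩, fun hM => hM.contractionStarDepth_eq⟩
  · obtain ⟨β, N, hN, hMN, hle⟩ := M.exists_isExtendedBy_contractionDepth_le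
    exact ⟨β, N, hN, hMN, hle.antisymm (Matroid.contractionStarDepth_lt_of_isExtendedBy hM hMN)⟩
  · rintro d ⟨β, N, hN, hMN, rfl⟩
    exact Matroid.contractionStarDepth_lt_of_isExtendedBy hM hMN
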